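/- **Model.** Let $n\ge 1$, $p\in(0,1]$ and let $w_1,\dots,w_n\in\mathbb R$ be the true attributes. Let $\Theta$ be a random real skew-symmetric $n\times n$ matrix whose entries $\Theta_{ij}$, $i<j$, are independent; with probability $p$ the offset $\Theta_{ij}$ equals $w_i-w_j$, and with probability $1-p$ it is uniformly distributed on $[0,2\pi)$. Let $\mathbf H$ be the Hermitian matrix with entries $\mathbf H_{ij}=e^{i\Theta_{ij}}$, let $z\in\mathbb C^n$ be the unit vector with $z_j=e^{iw_j}/\sqrt n$, and let $v_1$ be a (measurably chosen) eigenvector of $\mathbf H$ for its largest eigenvalue, $\|v_1\|^2=n$. Let $\rho=|\langle z,v_1\rangle|/(\|z\|\,\|v_1\|)$ be the correlation of $v_1$ and $z$, and let $\alpha=\arccos\rho\in[0,\pi/2]$ be the angle between them ($\tan^2\alpha=\infty$ if $\alpha=\pi/2$). **Theorem 2.** There is an absolute constant $c>0$ such that for every $\varepsilon>0$ there is $M>0$, depending only on $\varepsilon$, such that whenever $np^2\ge M$ (for all $n$, $p$, $w$ as above) the following hold. 1. For every truncation level $K$ with $1\le K\le e^{cn}$, $$\Big|\,np^2\;\mathbb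 E\min(\tan^2\alpha,K)-(1-p^2)\Big|\le\varepsilon\,(1-p^2);$$ that is, up to truncation, $\mathbb E\tan^2\alpha\sim\frac{1-p^2}{np^2}$ as $np^2\to\infty$. 2. If moreover $p\le 1/M$, then for every $K$ with $1\le K\le e^{cn}$, $$\Big|\,np^2\;\mathbb E\min(\tan^2\alpha,K)-1\Big|\le\varepsilon;$$ that is, up to truncation, $\mathbb E\tan^2\alpha\sim\frac1{np^2}$ as $np^2\to\infty$ and $p\to0$. 3. Without truncation, $\big|\,np^2\;\mathbb E(1-\rho^2)-(1-p^2)\big|\le\varepsilon\,(1-p^2)$. 4. $\mathbb P(\alpha>\varepsilon)\le\varepsilon$ and $\mathbb E\rho\ge1-\varepsilon$; that is, the angle between $v_1$ and $z$ tends to $0$ in probability and their correlation tends to $1$ as $np^2\to\infty$. -/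

import Mathlib

open MeasureTheory ProbabilityTheory
open scoped ENNReal Matrix

noncomputable section

namespace AttrSync

/-- Law of one measured offset between two nodes with true attributes `a` and `b`: with probability
`p` it equals `a - b`, otherwise it is uniform on `[0, 2π)`. -/
def offsetLaw (p a b : ℝ) : Measure ℝ :=
  ENNReal.ofReal p • Measure.dirac (a - b) +
    ENNReal.ofReal (1 - p) • (volume[|Set.Ico (0 : ℝ) (2 * Real.pi)])

/-- The noisy attribute synchronization model on `n` nodes with true attributes `w`: a random
skew-symmetric matrix of offsets whose entries above the diagonal are independent, each correct
with probability `p` and otherwise uniform. -/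
structure IsNoisyOffsets {n : ℕ} {Ω : Type*} [MeasurableSpace Ω] (μ : Measure Ω) (p : ℝ)
    (w : Fin n → ℝ) (Θ : Ω → Matrix (Fin n) (Fin n) ℝ) : Prop where
  skew : ∀ ω, (Θ ω)ᵀ = -Θ ω
  law : ∀ i j, i < j → HasLaw (fun ω => Θ ω i j) (offsetLaw p (w i) (w j)) μ
  indep : iIndepFun (fun (e : {e : Fin n × Fin n // e.1 < e.2}) ω => Θ ω e.1.1 e.1.2) μ

/-- The Hermitian matrix `H = exp(iΘ)`, the exponential being taken entrywise. -/
def phaseMatrix {n : ℕ} (Θ : Matrix (Fin n) (Fin n) ℝ) : Matrix (Fin n) (Fin n) ℂ :=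
  Matrix.of fun i j => Complex.exp (Complex.I * (Θ i j : ℂ))

/-- The normalized vector of true attributes, `z_i = exp(i w_i) / √n`. -/
def trueVector {n : ℕ} (w : Fin n → ℝ) : EuclideanSpace ℂ (Fin n) :=
  WithLp.toLp 2 fun i => Complex.exp (Complex.I * (w i : ℂ)) / (Real.sqrt n : ℂ)

/-- `v` is an eigenvector of `H` for its largest (real) eigenvalue, normalized by `‖v‖² = n`. -/
def IsTopEigenvector {n : ℕ} (H : Matrix (Fin n) (Fin n) ℂ) (v : EuclideanSpace ℂ (Fin n)) :
    Prop :=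
  ∃ l : ℝ,
    IsGreatest {t : ℝ | Module.End.HasEigenvalue (Matrix.toLin' H) (t : ℂ)} l ∧
    H *ᵥ v.ofLp = (l : ℂ) • v.ofLp ∧ ‖v‖ ^ 2 = n

/-- The correlation `|⟨z, v⟩| / (‖z‖ ‖v‖)`; it does not depend on the global phases. -/
def correlation {n : ℕ} (z v : EuclideanSpace ℂ (Fin n)) : ℝ :=
  ‖inner ℂ z v‖ / (‖z‖ * ‖v‖)

/-- The angle in `[0, π/2]` between (the complex lines spanned by) `z` and `v`. -/
def angle {n : ℕ} (z v : EuclideanSpace ℂ (Fin n)) : ℝ :=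
  Real.arccos (correlation z v)

/-- `tan² α` with values in `[0, ∞]`, equal to `∞` where `cos α = 0`. -/
def tanSq (α : ℝ) : ℝ≥0∞ :=
  ENNReal.ofReal (Real.sin α ^ 2) / ENNReal.ofReal (Real.cos α ^ 2)

/-- The truncated expectation `𝔼 min(tan² α, K)` of a random angle `α`. -/
def truncMeanTanSq {Ω : Type*} [MeasurableSpace Ω] (μ : Measure Ω) (α : Ω → ℝ) (K : ℝ) : ℝ :=
  (∫⁻ ω, min (tanSq (α ω)) (ENNReal.ofReal K) ∂μ).toReal

end AttrSync

end

/-! Write `H = np z z* + (1 - p) I + W`. The noise `W` is Hermitian with zero diagonal, and its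
entries above the diagonal are independent, centred, bounded by `2` and of second moment `1 - p²`.
The multiple of the identity does not move eigenvectors, so the top eigenvector is that of a
rank-one matrix perturbed by `W`.

Suppose `‖W‖ ≤ δ np`. Projecting the eigenvalue equation orthogonally to `z`, with the eigenvalue
pinned to `np (1 ± δ)` by its Rayleigh quotient, gives `tan α = (1 + O(δ)) ‖P W z‖ / (np)`
(`eigenvector_components`). Hence `tan² α` and `sin² α` are both within relative error `8δ` of
`noiseRatio = ‖P W z‖² / (np)²`. Its mean comes from second moments alone: `𝔼 ‖W z‖² = (n - 1)(1 -
p²)`, while the component of `W z` along `z` contributes at most `4 (1 - p²)`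
(`integral_noiseRatio`).

It remains to control the event where `W` is large. Hoeffding's inequality over pairs of net points
gives a failure probability of order `n² 625^n exp(-(δnp - 16)² / 256)`. Its exponent is of order
`δ² np² · n`, so for large `np²` it beats a truncation level `e^n`; truncation is what controls the
infinite or huge values of `tan²` there.

The error must also be small relative to `1 - p²`, which vanishes as `p → 1`. If every offset is
correct then `H = n z z*` exactly and the angle is zero, so failure only matters together with some
wrong offset. A wrong offset costs a factor `1 - p`, and independence keeps that factor next to the
Hoeffding bound (`measureReal_noise_large_le`). The remaining claims follow from `𝔼 (1 - ρ²) ≤ 2 /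
(np²)` by Markov's inequality and `ρ² ≤ ρ`. -/

namespace AttrSync

/-! ### Nets and operator norms -/

/-- The ball of radius `2` of a finite-dimensional real normed space has a `1`-net with at most
`5 ^ dim` points. -/
theorem exists_net (E : Type*) [NormedAddCommGroup E] [NormedSpace ℝ E] [FiniteDimensional ℝ E] :
    ∃ N : Finset E, N.card ≤ 5 ^ Module.finrank ℝ E ∧ (∀ x ∈ N, ‖x‖ ≤ 2) ∧
      ∀ x : E, ‖x‖ ≤ 2 → ∃ y ∈ N, ‖x - y‖ ≤ 1 := by
  classical
  let S : Set ℕ := {k | ∃ N : Finset E, N.card = k ∧ (∀ x ∈ N, ‖x‖ ≤ 2) ∧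
    ∀ c ∈ N, ∀ d ∈ N, c ≠ d → 1 ≤ ‖c - d‖}
  have hbdd : BddAbove S := ⟨5 ^ Module.finrank ℝ E, by
    rintro k ⟨N, rfl, h1, h2⟩
    exact Besicovitch.card_le_of_separated N h1 h2⟩
  have hne : S.Nonempty := ⟨0, ∅, by simp⟩
  -- A separated set of maximal cardinality is a net: an uncovered point could be added to it.
  obtain ⟨N, hNk, hN1, hN2⟩ := Nat.sSup_mem hne hbdd
  refine ⟨N, Besicovitch.card_le_of_separated N hN1 hN2, hN1, fun x hx => ?_⟩
  by_contra! hcon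
  have hxN : x ∉ N := fun h => by
    have := hcon x h
    simp at this
    linarith
  have hmem : N.card + 1 ∈ S := by
    refine ⟨insert x N, Finset.card_insert_of_notMem hxN, ?_, ?_⟩
    · intro y hy
      rcases Finset.mem_insert.1 hy with rfl | hy
      · exact hx
      · exact hN1 y hy
    · intro c hc d hd hcd
      rcases Finset.mem_insert.1 hc with hcx | hcN <;> rcases Finset.mem_insert.1 hd with hdx | hdN
      · exact absurd (hcx.trans hdx.symm) hcd
      · rw [hcx]; exact (hcon d hdN).le
      · rw [hdx, norm_sub_rev]; exact (hcon c hcN).le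
      · exact hN2 c hcN d hdN hcd
  have := le_csSup hbdd hmem
  omega

section InnerProduct

variable {E : Type*} [NormedAddCommGroup E] [InnerProductSpace ℂ E]

/-- Testing `u` against `2u / ‖u‖` yields `2‖u‖`, and moving to a net point loses at most `‖u‖`.
Radius `2` with mesh `1` therefore costs no constant. -/
theorem norm_le_of_net {N : Finset E} (hN : ∀ x : E, ‖x‖ ≤ 2 → ∃ y ∈ N, ‖x - y‖ ≤ 1)
    {u : E} {m : ℝ} (h : ∀ x ∈ N, (inner ℂ x u).re ≤ m) : ‖u‖ ≤ m := by
  set x : E := ((2 / ‖u‖ : ℝ) : ℂ) • u with hx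
  have hx2 : ‖x‖ ≤ 2 := by
    rw [hx, norm_smul, Complex.norm_real, Real.norm_of_nonneg (by positivity)]
    rcases eq_or_ne ‖u‖ 0 with h0 | h0
    · simp [h0]
    · rw [div_mul_cancel₀ _ h0]
  obtain ⟨y, hy, hxy⟩ := hN x hx2
  have h1 : (inner ℂ x u).re = 2 * ‖u‖ := by
    rw [hx, inner_smul_left, Complex.conj_ofReal, Complex.re_ofReal_mul, inner_self_eq_norm_sq_to_K]
    norm_cast
    rcases eq_or_ne ‖u‖ 0 with h0 | h0
    · simp [h0]
    · field_simp
      norm_cast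
  have h2 : (inner ℂ (x - y) u).re ≤ ‖u‖ := by
    refine (Complex.re_le_norm _).trans ((norm_inner_le_norm _ _).trans ?_)
    nlinarith [norm_nonneg u]
  rw [inner_sub_left, Complex.sub_re] at h2
  linarith [h y hy]

theorem norm_apply_le_of_net [FiniteDimensional ℂ E] {N : Finset E}
    (hN : ∀ x : E, ‖x‖ ≤ 2 → ∃ y ∈ N, ‖x - y‖ ≤ 1) (T : E →ₗ[ℂ] E) {t : ℝ}
    (h : ∀ x ∈ N, ∀ y ∈ N, (inner ℂ x (T y)).re ≤ t) (x : E) : ‖T x‖ ≤ t * ‖x‖ := by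
  let T' : E →L[ℂ] E := LinearMap.toContinuousLinearMap T
  have hT' : ∀ x, T' x = T x := fun _ => rfl
  have h1 : ∀ y ∈ N, ‖T y‖ ≤ t := fun y hy => norm_le_of_net hN fun x hx => h x hx y hy
  obtain ⟨y₀, hy₀, -⟩ := hN 0 (by simp)
  have ht : 0 ≤ t := (norm_nonneg _).trans (h1 y₀ hy₀)
  -- The same loss for operators: the finite norm `‖T'‖` reappears with factor `1/2` and is
  -- absorbed.
  have h2 : ‖T'‖ ≤ (t + ‖T'‖) / 2 := by
    refine T'.opNorm_le_bound (by positivity) fun u => ?_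
    rcases eq_or_ne ‖u‖ 0 with h0 | h0
    · rw [norm_eq_zero] at h0
      simp [h0]
    have hpos : 0 < ‖u‖ := lt_of_le_of_ne (norm_nonneg _) h0.symm
    set y : E := ((2 / ‖u‖ : ℝ) : ℂ) • u with hy
    have hy2 : ‖y‖ ≤ 2 := by
      rw [hy, norm_smul, Complex.norm_real, Real.norm_of_nonneg (by positivity),
        div_mul_cancel₀ _ h0]
    obtain ⟨d, hd, hyd⟩ := hN y hy2
    have h3 : ‖T' y‖ = 2 / ‖u‖ * ‖T' u‖ := by
      rw [hy, map_smul, norm_smul, Complex.norm_real, Real.norm_of_nonneg (by positivity)]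
    have h4 : ‖T' y‖ ≤ t + ‖T'‖ := by
      calc ‖T' y‖ = ‖T' d + T' (y - d)‖ := by rw [← map_add]; simp
        _ ≤ ‖T' d‖ + ‖T' (y - d)‖ := norm_add_le _ _
        _ ≤ t + ‖T'‖ * 1 := by
            gcongr
            · exact h1 d hd
            · exact (T'.le_opNorm _).trans (by gcongr)
        _ = t + ‖T'‖ := by ring
    rw [h3] at h4
    rw [div_mul_eq_mul_div, div_le_iff₀ hpos] at h4
    linarith
  have h3 : ‖T'‖ ≤ t := by linarith
  calc ‖T x‖ = ‖T' x‖ := rfl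
    _ ≤ ‖T'‖ * ‖x‖ := T'.le_opNorm x
    _ ≤ t * ‖x‖ := by gcongr

/-! ### Eigenvectors of a perturbed rank-one operator -/

/-- The component of `x` orthogonal to the unit vector `z`. -/
noncomputable def perp (z x : E) : E := x - inner ℂ z x • z

theorem inner_perp {z : E} (hz : ‖z‖ = 1) (x : E) : inner ℂ z (perp z x) = 0 := by
  rw [perp, inner_sub_right, inner_smul_right, inner_self_eq_norm_sq_to_K, hz]
  simp

theorem norm_perp_sq {z : E} (hz : ‖z‖ = 1) (x : E) :
    ‖perp z x‖ ^ 2 = ‖x‖ ^ 2 - ‖inner ℂ z x‖ ^ 2 := by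
  have h : x = perp z x + inner ℂ z x • z := by simp [perp]
  have h2 : inner ℂ (perp z x) (inner ℂ z x • z) = 0 := by
    rw [inner_smul_right, inner_eq_zero_symm.1 (inner_perp hz x), mul_zero]
  have h3 := norm_add_sq_eq_norm_sq_add_norm_sq_of_inner_eq_zero _ _ h2
  rw [← h, norm_smul, hz] at h3
  nlinarith

theorem norm_perp_le {z : E} (hz : ‖z‖ = 1) (x : E) : ‖perp z x‖ ≤ ‖x‖ := by
  refine abs_le_of_sq_le_sq' ?_ (norm_nonneg _) |>.2
  rw [norm_perp_sq hz]
  nlinarith [norm_nonneg (inner ℂ z x)]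

theorem perp_add (z x y : E) : perp z (x + y) = perp z x + perp z y := by
  simp only [perp, inner_add_right, add_smul]; abel

theorem perp_smul (z : E) (c : ℂ) (x : E) : perp z (c • x) = c • perp z x := by
  simp only [perp, inner_smul_right, smul_sub, mul_smul]

theorem perp_self {z : E} (hz : ‖z‖ = 1) : perp z z = 0 := by
  rw [perp, inner_self_eq_norm_sq_to_K, hz]; simp

/-- An eigenvector of a rank-one operator `L z z*` perturbed by an operator `T` of norm at most
`δ L`, whose eigenvalue is at least the Rayleigh quotient at `z`: the ratio of its components
orthogonal and parallel to `z` is close to `‖P T z‖ / L`. -/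
theorem eigenvector_components {z v : E} (hz : ‖z‖ = 1) (T : E →ₗ[ℂ] E) {L δ m : ℝ}
    (hT : ∀ x, ‖T x‖ ≤ δ * L * ‖x‖) (hv : v ≠ 0) (hL : 0 ≤ L)
    (heig : ((L : ℂ) * inner ℂ z v) • z + T v = (m : ℂ) • v)
    (hm : L + (inner ℂ z (T z)).re ≤ m) :
    L * (1 - 2 * δ) * ‖perp z v‖ ≤ ‖inner ℂ z v‖ * ‖perp z (T z)‖ ∧
    ‖inner ℂ z v‖ * ‖perp z (T z)‖ ≤ L * (1 + 2 * δ) * ‖perp z v‖ := by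
  have hv0 : 0 < ‖v‖ := norm_pos_iff.2 hv
  have hzT : ‖inner ℂ z (T z)‖ ≤ δ * L := by
    refine (norm_inner_le_norm _ _).trans ?_
    have := hT z
    rw [hz] at this ⊢
    linarith
  have hm1 : L - δ * L ≤ m := by
    have := (abs_le.1 ((Complex.abs_re_le_norm _).trans hzT)).1
    linarith
  have hm2 : m ≤ L + δ * L := by
    have h1 : ‖(m : ℂ) • v‖ ≤ L * ‖v‖ + δ * L * ‖v‖ := by
      rw [← heig]
      refine (norm_add_le _ _).trans (add_le_add ?_ (hT v))
      rw [norm_smul, hz, norm_mul, Complex.norm_real, Real.norm_of_nonneg hL, mul_one]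
      gcongr
      simpa [hz] using norm_inner_le_norm (𝕜 := ℂ) z v
    rw [norm_smul, Complex.norm_real] at h1
    have h2 : ‖m‖ ≤ L + δ * L := by
      by_contra! hc
      nlinarith
    exact (le_abs_self m).trans h2
  set b := perp z v with hb
  have hdec : v = inner ℂ z v • z + b := by simp [hb, perp]
  -- Projecting the eigenvalue equation off `z` removes the rank-one term. Since `m` is within `δL`
  -- of `L` and `T b` has norm at most `δL‖b‖`, the total error is `2δL‖b‖`.
  have hkey : inner ℂ z v • perp z (T z) + perp z (T b) = (m : ℂ) • b := by
    have h1 := congrArg (perp z) heig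
    rw [perp_add, perp_smul, perp_self hz, smul_zero, zero_add, perp_smul, ← hb] at h1
    rw [← h1]
    conv_rhs => rw [hdec]
    rw [map_add, map_smul, perp_add, perp_smul]
  have hTb : ‖perp z (T b)‖ ≤ δ * L * ‖b‖ := (norm_perp_le hz _).trans (hT b)
  have hn : ‖inner ℂ z v • perp z (T z)‖ = ‖inner ℂ z v‖ * ‖perp z (T z)‖ := norm_smul _ _
  have hmb : ‖(m : ℂ) • b‖ = |m| * ‖b‖ := by rw [norm_smul, Complex.norm_real, Real.norm_eq_abs]
  have hδL : 0 ≤ δ * L := (norm_nonneg _).trans hzT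
  have habs : |m| ≤ L + δ * L := abs_le.2 ⟨by linarith, hm2⟩
  constructor
  · have h1 : ‖(m : ℂ) • b‖ ≤ ‖inner ℂ z v‖ * ‖perp z (T z)‖ + δ * L * ‖b‖ := by
      rw [← hkey, ← hn]
      exact (norm_add_le _ _).trans (by gcongr)
    rw [hmb] at h1
    nlinarith [norm_nonneg b, le_abs_self m]
  · have h1 : ‖inner ℂ z v‖ * ‖perp z (T z)‖ ≤ ‖(m : ℂ) • b‖ + δ * L * ‖b‖ := by
      rw [← hkey, ← hn]
      refine (norm_le_add_norm_add _ _).trans (by gcongr)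
    rw [hmb] at h1
    nlinarith [norm_nonneg b]

end InnerProduct

/-- With `r` the tangent, `r² / (1 + r²)` is the squared sine and is at most `r²`. An upper bound
for the tangent and a lower bound for the sine thus control both on both sides. -/
theorem sq_bounds {r q δ : ℝ} (hr0 : 0 ≤ r) (hq0 : 0 ≤ q) (hqδ : q ≤ δ) (hδ' : δ ≤ 1 / 10)
    (g1 : (1 - 2 * δ) * r ≤ q) (g2 : q ≤ (1 + 2 * δ) * r) :
    r ^ 2 ≤ 1 ∧ r ^ 2 ≤ (1 + 8 * δ) * q ^ 2 ∧ (1 - 8 * δ) * q ^ 2 ≤ r ^ 2 / (1 + r ^ 2) := by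
  have hδ : 0 ≤ δ := hq0.trans hqδ
  have hr1 : r ≤ 5 / 4 * q := by nlinarith
  have hr2 : r ≤ 1 / 8 := by linarith
  have hrδ : r ^ 2 ≤ δ := by nlinarith
  refine ⟨by linarith, ?_, ?_⟩
  · have hk : (1 - 2 * δ) ^ 2 * r ^ 2 ≤ q ^ 2 := by
      rw [← mul_pow]; exact pow_le_pow_left₀ (mul_nonneg (by linarith) hr0) g1 2
    have hk2 : 1 ≤ (1 + 8 * δ) * (1 - 2 * δ) ^ 2 := by
      have : (1 + 8 * δ) * (1 - 2 * δ) ^ 2 = 1 + δ * (4 - 28 * δ + 32 * δ ^ 2) := by ring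
      rw [this]
      have : 0 ≤ 4 - 28 * δ + 32 * δ ^ 2 := by linarith [sq_nonneg δ]
      linarith [mul_nonneg hδ this]
    calc r ^ 2 = 1 * r ^ 2 := by ring
      _ ≤ (1 + 8 * δ) * (1 - 2 * δ) ^ 2 * r ^ 2 := by gcongr
      _ = (1 + 8 * δ) * ((1 - 2 * δ) ^ 2 * r ^ 2) := by ring
      _ ≤ (1 + 8 * δ) * q ^ 2 := by gcongr
  · have hk : q ^ 2 ≤ (1 + 2 * δ) ^ 2 * r ^ 2 := by
      rw [← mul_pow]; exact pow_le_pow_left₀ hq0 g2 2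
    rw [le_div_iff₀ (by positivity)]
    have hk2 : (1 - 8 * δ) * (1 + r ^ 2) * (1 + 2 * δ) ^ 2 ≤ 1 := by
      have h3 : (1 - 8 * δ) * (1 + δ) * (1 + 2 * δ) ^ 2 =
          1 - δ * (3 + 32 * δ + 60 * δ ^ 2 + 32 * δ ^ 3) := by ring
      have h4 : 0 ≤ δ * (3 + 32 * δ + 60 * δ ^ 2 + 32 * δ ^ 3) := by positivity
      have h5 : (1 - 8 * δ) * (1 + r ^ 2) * (1 + 2 * δ) ^ 2 ≤
          (1 - 8 * δ) * (1 + δ) * (1 + 2 * δ) ^ 2 := by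
        gcongr
        linarith
      linarith
    have h8 : 0 ≤ 1 - 8 * δ := by linarith
    calc (1 - 8 * δ) * q ^ 2 * (1 + r ^ 2)
        ≤ (1 - 8 * δ) * ((1 + 2 * δ) ^ 2 * r ^ 2) * (1 + r ^ 2) := by gcongr
      _ = (1 - 8 * δ) * (1 + r ^ 2) * (1 + 2 * δ) ^ 2 * r ^ 2 := by ring
      _ ≤ 1 * r ^ 2 := by gcongr
      _ = r ^ 2 := one_mul _

/-- The quotients `β² / a²` and `β² / (a² + β²)` are both close to `s² / L²` when `β / a` is close
to `s / L` and `s / L` is small. -/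
theorem ratio_bounds {a β s L δ : ℝ} (ha : 0 ≤ a) (hβ : 0 ≤ β) (hs : 0 ≤ s) (hL : 0 < L)
    (hδ' : δ ≤ 1 / 10) (hV : 0 < a ^ 2 + β ^ 2) (hsL : s ≤ δ * L)
    (h1 : L * (1 - 2 * δ) * β ≤ a * s) (h2 : a * s ≤ L * (1 + 2 * δ) * β) :
    0 < a ∧ β ^ 2 / a ^ 2 ≤ 1 ∧ |β ^ 2 / a ^ 2 - s ^ 2 / L ^ 2| ≤ 8 * δ * (s ^ 2 / L ^ 2) ∧
      |β ^ 2 / (a ^ 2 + β ^ 2) - s ^ 2 / L ^ 2| ≤ 8 * δ * (s ^ 2 / L ^ 2) := by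
  -- If `a = 0`, the first inequality forces `β = 0`, and the vector would vanish.
  have ha0 : 0 < a := by
    refine lt_of_le_of_ne ha fun h => ?_
    subst h
    have hpos : 0 < β := lt_of_le_of_ne hβ fun h => by simp [← h] at hV
    have h12 : 0 < 1 - 2 * δ := by linarith
    have : 0 < L * (1 - 2 * δ) * β := by positivity
    linarith
  obtain ⟨r, rfl⟩ : ∃ r, β = r * a := ⟨β / a, by field_simp⟩
  obtain ⟨q, rfl⟩ : ∃ q, s = q * L := ⟨s / L, by field_simp⟩
  have hr0 : 0 ≤ r := nonneg_of_mul_nonneg_left hβ ha0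
  have hq0 : 0 ≤ q := nonneg_of_mul_nonneg_left hs hL
  have hqδ : q ≤ δ := le_of_mul_le_mul_right hsL hL
  have g1 : (1 - 2 * δ) * r ≤ q := by
    have : L * a * ((1 - 2 * δ) * r) ≤ L * a * q := by linarith
    exact le_of_mul_le_mul_left this (by positivity)
  have g2 : q ≤ (1 + 2 * δ) * r := by
    have : L * a * q ≤ L * a * ((1 + 2 * δ) * r) := by linarith
    exact le_of_mul_le_mul_left this (by positivity)
  have e1 : (r * a) ^ 2 / a ^ 2 = r ^ 2 := by field_simp
  have e2 : (q * L) ^ 2 / L ^ 2 = q ^ 2 := by field_simp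
  have e3 : (r * a) ^ 2 / (a ^ 2 + (r * a) ^ 2) = r ^ 2 / (1 + r ^ 2) := by field_simp
  obtain ⟨b1, b2, b3⟩ := sq_bounds hr0 hq0 hqδ hδ' g1 g2
  have u2 : r ^ 2 / (1 + r ^ 2) ≤ r ^ 2 :=
    div_le_self (sq_nonneg _) (by linarith [sq_nonneg r])
  rw [e1, e2, e3]
  exact ⟨ha0, b1, abs_le.2 ⟨by linarith, by linarith⟩, abs_le.2 ⟨by linarith, by linarith⟩⟩

/-- The largest eigenvalue of a Hermitian matrix bounds its Rayleigh quotient. -/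
theorem re_inner_le_of_isGreatest {n : ℕ} {H : Matrix (Fin n) (Fin n) ℂ} (hH : H.IsHermitian)
    {l : ℝ} (hl : IsGreatest {t : ℝ | Module.End.HasEigenvalue (Matrix.toLin' H) (t : ℂ)} l)
    (x : EuclideanSpace ℂ (Fin n)) :
    (inner ℂ x (Matrix.toEuclideanLin H x)).re ≤ l * ‖x‖ ^ 2 := by
  set T := Matrix.toEuclideanLin H with hTdef
  have hT : T.IsSymmetric := Matrix.isSymmetric_toEuclideanLin_iff.2 hH
  have hn : Module.finrank ℂ (EuclideanSpace ℂ (Fin n)) = n := by simp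
  have hle : ∀ i, hT.eigenvalues hn i ≤ l := fun i => by
    refine hl.2 ?_
    have h1 := hT.hasEigenvalue_eigenvalues hn i
    obtain ⟨u, hu⟩ := h1.exists_hasEigenvector
    have hu1 : T u = ((hT.eigenvalues hn i : ℝ) : ℂ) • u := hu.apply_eq_smul
    refine Module.End.hasEigenvalue_of_hasEigenvector (x := u.ofLp) ⟨?_, ?_⟩
    · rw [Module.End.mem_eigenspace_iff, Matrix.toLin'_apply]
      have := congrArg WithLp.ofLp hu1
      simpa [hTdef] using this
    · intro h0
      exact hu.2 (by ext i; simp [h0])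
  let b := hT.eigenvectorBasis hn
  have h1 : inner ℂ x (T x) = ∑ i, ((hT.eigenvalues hn i * ‖inner ℂ (b i) x‖ ^ 2 : ℝ) : ℂ) := by
    rw [← b.sum_inner_mul_inner]
    refine Finset.sum_congr rfl fun i _ => ?_
    have h2 : inner ℂ (b i) (T x) = (hT.eigenvalues hn i : ℂ) * inner ℂ (b i) x := by
      rw [← hT, hT.apply_eigenvectorBasis, inner_smul_left]
      simp [b]
    rw [h2, ← inner_conj_symm x (b i)]
    push_cast
    rw [← Complex.conj_mul']
    ring
  rw [h1, ← Complex.ofReal_sum, Complex.ofReal_re, ← b.sum_sq_norm_inner_right x, Finset.mul_sum]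
  exact Finset.sum_le_sum fun i _ => mul_le_mul_of_nonneg_right (hle i) (sq_nonneg _)

end AttrSync

/-! ### Moments of the centred phases -/

namespace AttrSync

/-- The centred phase `exp(it) - p exp(ia)` of a measured offset `t` whose true value is `a`. -/
noncomputable def centredPhase (p a t : ℝ) : ℂ :=
  Complex.exp (Complex.I * (t : ℂ)) - (p : ℂ) * Complex.exp (Complex.I * (a : ℂ))

@[fun_prop]
theorem continuous_centredPhase (p a : ℝ) : Continuous (centredPhase p a) := by
  unfold centredPhase; fun_prop

theorem norm_exp_I_mul (t : ℝ) : ‖Complex.exp (Complex.I * (t : ℂ))‖ = 1 := by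
  rw [mul_comm, Complex.norm_exp_ofReal_mul_I]

theorem norm_centredPhase_le {p : ℝ} (hp : 0 ≤ p) (hp' : p ≤ 1) (a t : ℝ) :
    ‖centredPhase p a t‖ ≤ 2 := by
  refine (norm_sub_le _ _).trans ?_
  rw [norm_mul, norm_exp_I_mul, norm_exp_I_mul, Complex.norm_real, Real.norm_of_nonneg hp]
  linarith

theorem centredPhase_neg (p a t : ℝ) :
    centredPhase p (-a) (-t) = (starRingEnd ℂ) (centredPhase p a t) := by
  simp only [centredPhase, map_sub, map_mul, ← Complex.exp_conj, Complex.conj_I,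
    Complex.conj_ofReal, Complex.ofReal_neg, mul_neg, neg_mul]

/-- Both phases are unimodular, so the only random term is linear in `exp (I t)` and the second
moment reduces to the first. -/
theorem norm_centredPhase_sq (p a t : ℝ) : ‖centredPhase p a t‖ ^ 2 =
    1 + p ^ 2 - 2 * p * (Complex.exp (Complex.I * (t : ℂ)) *
      (starRingEnd ℂ) (Complex.exp (Complex.I * (a : ℂ)))).re := by
  have h1 : Complex.normSq (Complex.exp (Complex.I * (t : ℂ))) = 1 := by
    rw [Complex.normSq_eq_norm_sq, norm_exp_I_mul]; norm_num
  have h2 : Complex.normSq (Complex.exp (Complex.I * (a : ℂ))) = 1 := by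
    rw [Complex.normSq_eq_norm_sq, norm_exp_I_mul]; norm_num
  rw [← Complex.normSq_eq_norm_sq, centredPhase, Complex.normSq_sub, h1, Complex.normSq_mul, h2,
    Complex.normSq_ofReal, map_mul, Complex.conj_ofReal, mul_left_comm, Complex.re_ofReal_mul]
  ring

section Law

variable {Ω : Type*} [MeasurableSpace Ω] {μ : Measure Ω} {p a b : ℝ} {X : Ω → ℝ}

theorem integral_exp_uniform :
    ∫ t, Complex.exp (Complex.I * (t : ℂ)) ∂(volume[|Set.Ico (0 : ℝ) (2 * Real.pi)]) = 0 := by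
  rw [ProbabilityTheory.cond, integral_smul_measure, ← integral_Icc_eq_integral_Ico,
    integral_Icc_eq_integral_Ioc, ← intervalIntegral.integral_of_le (by positivity),
    integral_exp_mul_complex Complex.I_ne_zero]
  have : Complex.I * ((2 * Real.pi : ℝ) : ℂ) = 2 * Real.pi * Complex.I := by push_cast; ring
  rw [this, Complex.exp_two_pi_mul_I]
  simp

theorem integral_exp_offset (hp : 0 ≤ p) (hX : HasLaw X (offsetLaw p a b) μ) :
    ∫ ω, Complex.exp (Complex.I * (X ω : ℂ)) ∂μ = p * Complex.exp (Complex.I * ((a - b : ℝ) : ℂ)) := by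
  have hf : Continuous fun t : ℝ => Complex.exp (Complex.I * (t : ℂ)) := by fun_prop
  have hb : ∀ t : ℝ, ‖Complex.exp (Complex.I * (t : ℂ))‖ ≤ 1 := fun t => (norm_exp_I_mul t).le
  rw [← integral_map (f := fun t : ℝ => Complex.exp (Complex.I * (t : ℂ))) hX.aemeasurable
    hf.aestronglyMeasurable, hX.map_eq, offsetLaw, integral_add_measure, integral_smul_measure,
    integral_smul_measure, integral_exp_uniform, integral_dirac, smul_zero, add_zero,
    ENNReal.toReal_ofReal hp, Complex.real_smul]
  · exact (Integrable.of_bound hf.aestronglyMeasurable 1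
      (Filter.Eventually.of_forall hb)).smul_measure ENNReal.ofReal_ne_top
  · exact (Integrable.of_bound hf.aestronglyMeasurable 1
      (Filter.Eventually.of_forall hb)).smul_measure ENNReal.ofReal_ne_top

/-- The source of the factor `1 - p` in the failure bound: only the uniform part of the law charges
wrong values. -/
theorem measureReal_offset_ne_le (hp' : p ≤ 1) (hX : HasLaw X (offsetLaw p a b) μ) :
    μ.real {ω | X ω ≠ a - b} ≤ 1 - p := by
  have hm : MeasurableSet {t : ℝ | t ≠ a - b} := (measurableSet_singleton _).compl
  rw [Measure.real, hX.measure_eq hm]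
  refine ENNReal.toReal_le_of_le_ofReal (by linarith) ?_
  rw [offsetLaw, Measure.add_apply, Measure.smul_apply, Measure.smul_apply,
    Measure.dirac_apply' _ hm]
  have h0 : Set.indicator {t : ℝ | t ≠ a - b} (1 : ℝ → ℝ≥0∞) (a - b) = 0 := by simp
  rw [h0, smul_zero, zero_add, smul_eq_mul]
  exact mul_le_of_le_one_right' prob_le_one

theorem integrable_exp_offset [IsProbabilityMeasure μ] (hX : AEMeasurable X μ) :
    Integrable (fun ω => Complex.exp (Complex.I * (X ω : ℂ))) μ := by
  have hf : Continuous fun t : ℝ => Complex.exp (Complex.I * (t : ℂ)) := by fun_prop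
  exact Integrable.of_bound (hf.measurable.comp_aemeasurable hX).aestronglyMeasurable 1
    (Filter.Eventually.of_forall fun ω => (norm_exp_I_mul _).le)

theorem integral_centredPhase [IsProbabilityMeasure μ] (hp : 0 ≤ p) (hX : HasLaw X (offsetLaw p a b) μ) :
    ∫ ω, centredPhase p (a - b) (X ω) ∂μ = 0 := by
  unfold centredPhase
  rw [integral_sub (integrable_exp_offset hX.aemeasurable) (integrable_const _),
    integral_exp_offset hp hX]
  simp

theorem integral_norm_centredPhase_sq [IsProbabilityMeasure μ] (hp : 0 ≤ p) (hX : HasLaw X (offsetLaw p a b) μ) :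
    ∫ ω, ‖centredPhase p (a - b) (X ω)‖ ^ 2 ∂μ = 1 - p ^ 2 := by
  have hi : Integrable (fun ω => Complex.exp (Complex.I * (X ω : ℂ)) *
      (starRingEnd ℂ) (Complex.exp (Complex.I * ((a - b : ℝ) : ℂ)))) μ :=
    (integrable_exp_offset hX.aemeasurable).mul_const _
  simp only [norm_centredPhase_sq]
  rw [integral_sub (integrable_const _) (Integrable.const_mul (μ := μ) (f := fun ω =>
    (Complex.exp (Complex.I * (X ω : ℂ)) *
      (starRingEnd ℂ) (Complex.exp (Complex.I * ((a - b : ℝ) : ℂ)))).re) hi.re _),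
    integral_const_mul]
  have h1 : ∫ ω, (Complex.exp (Complex.I * (X ω : ℂ)) *
      (starRingEnd ℂ) (Complex.exp (Complex.I * ((a - b : ℝ) : ℂ)))).re ∂μ = p := by
    have h2 := integral_re hi
    rw [integral_mul_const, integral_exp_offset hp hX, mul_assoc, Complex.mul_conj',
      norm_exp_I_mul] at h2
    simpa using h2
  rw [h1]
  simp
  ring

end Law

/-! ### Second moments of independent sums, used over `ℝ` for functionals and over `ℂ` for rows -/

section Uncorrelated

variable {Ω 𝕜 ι : Type*} [RCLike 𝕜] [MeasurableSpace Ω] {μ : Measure Ω} [IsProbabilityMeasure μ]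

/-- The second moment of a sum of bounded, centred, pairwise independent variables. -/
theorem integral_norm_sum_sq (s : Finset ι) (Y : ι → Ω → 𝕜) (C : ℝ)
    (hm : ∀ i ∈ s, AEMeasurable (Y i) μ) (hC : ∀ i ∈ s, ∀ ω, ‖Y i ω‖ ≤ C)
    (h0 : ∀ i ∈ s, ∫ ω, Y i ω ∂μ = 0)
    (hind : ∀ i ∈ s, ∀ j ∈ s, i ≠ j → IndepFun (Y i) (Y j) μ) :
    ∫ ω, ‖∑ i ∈ s, Y i ω‖ ^ 2 ∂μ = ∑ i ∈ s, ∫ ω, ‖Y i ω‖ ^ 2 ∂μ := by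
  classical
  have hInt : ∀ i ∈ s, ∀ j ∈ s,
      Integrable (fun ω => Y i ω * (starRingEnd 𝕜) (Y j ω)) μ := fun i hi j hj => by
    refine Integrable.of_bound ?_ (C * C) (Filter.Eventually.of_forall fun ω => ?_)
    · exact ((hm i hi).mul (RCLike.continuous_conj.measurable.comp_aemeasurable
        (hm j hj))).aestronglyMeasurable
    · rw [norm_mul, RCLike.norm_conj]
      exact mul_le_mul (hC i hi ω) (hC j hj ω) (norm_nonneg _)
        ((norm_nonneg _).trans (hC i hi ω))
  have hsq : ∀ y : 𝕜, ((‖y‖ ^ 2 : ℝ) : 𝕜) = y * (starRingEnd 𝕜) y := fun y => by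
    rw [RCLike.mul_conj]; push_cast; rfl
  have key : ∫ ω, ((‖∑ i ∈ s, Y i ω‖ ^ 2 : ℝ) : 𝕜) ∂μ =
      ∑ i ∈ s, ∫ ω, ((‖Y i ω‖ ^ 2 : ℝ) : 𝕜) ∂μ := by
    simp only [hsq, map_sum, Finset.sum_mul_sum]
    rw [integral_finsetSum _ fun i hi => integrable_finsetSum _ fun j hj => hInt i hi j hj]
    refine Finset.sum_congr rfl fun i hi => ?_
    rw [integral_finsetSum _ fun j hj => hInt i hi j hj, Finset.sum_eq_single_of_mem i hi]
    intro j hj hij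
    have hind' : IndepFun (Y i) (fun ω => (starRingEnd 𝕜) (Y j ω)) μ :=
      (hind i hi j hj hij.symm).comp measurable_id RCLike.continuous_conj.measurable
    rw [hind'.integral_fun_mul_eq_mul_integral (hm i hi).aestronglyMeasurable
      (RCLike.continuous_conj.measurable.comp_aemeasurable (hm j hj)).aestronglyMeasurable,
      h0 i hi, zero_mul]
  simp only [integral_ofReal, ← RCLike.ofReal_sum] at key
  exact_mod_cast key

end Uncorrelated

/-! ### The sesquilinear form of the noise as a sum over edges -/

theorem sum_sum_eq_sum_edges {n : ℕ} {A : Type*} [AddCommMonoid A] (F : Fin n → Fin n → A)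
    (hF : ∀ i, F i i = 0) :
    ∑ i, ∑ j, F i j =
      ∑ e : {e : Fin n × Fin n // e.1 < e.2}, (F e.1.1 e.1.2 + F e.1.2 e.1.1) := by
  have h1 : ∑ e : {e : Fin n × Fin n // e.1 < e.2}, (F e.1.1 e.1.2 + F e.1.2 e.1.1) =
      ∑ e ∈ Finset.univ.filter (fun e : Fin n × Fin n => e.1 < e.2),
        (F e.1 e.2 + F e.2 e.1) :=
    (Finset.sum_subtype (p := fun e : Fin n × Fin n => e.1 < e.2)
      (Finset.univ.filter fun e : Fin n × Fin n => e.1 < e.2) (by simp)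
      (fun e => F e.1 e.2 + F e.2 e.1)).symm
  have h2 : ∑ e ∈ Finset.univ.filter (fun e : Fin n × Fin n => e.1 < e.2), F e.2 e.1 =
      ∑ e ∈ Finset.univ.filter (fun e : Fin n × Fin n => ¬ e.1 < e.2), F e.1 e.2 := by
    have h3 : ∑ e ∈ Finset.univ.filter (fun e : Fin n × Fin n => e.2 < e.1), F e.1 e.2 =
        ∑ e ∈ Finset.univ.filter (fun e : Fin n × Fin n => ¬ e.1 < e.2), F e.1 e.2 := by
      refine Finset.sum_subset (fun e he => ?_) (fun e he he' => ?_)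
      · simp only [Finset.mem_filter, Finset.mem_univ, true_and] at he ⊢
        exact not_lt.2 he.le
      · simp only [Finset.mem_filter, Finset.mem_univ, true_and, not_lt] at he he'
        rw [le_antisymm he' he, hF]
    rw [← h3]
    refine Finset.sum_equiv (Equiv.prodComm _ _) ?_ ?_ <;> simp
  rw [h1, Finset.sum_add_distrib, h2, Finset.sum_filter_add_sum_filter_not,
    Fintype.sum_prod_type]

/-- The centred part of the phase matrix, with zero diagonal. -/
noncomputable def noiseMatrix {n : ℕ} (p : ℝ) (w : Fin n → ℝ) (Θ : Matrix (Fin n) (Fin n) ℝ) :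
    Matrix (Fin n) (Fin n) ℂ :=
  Matrix.of fun i j => if i = j then 0 else centredPhase p (w i - w j) (Θ i j)

/-- The coefficient of the centred phase of an edge in the sesquilinear form of the noise. -/
noncomputable def edgeCoeff {n : ℕ} (x y : EuclideanSpace ℂ (Fin n))
    (e : {e : Fin n × Fin n // e.1 < e.2}) : ℂ :=
  (starRingEnd ℂ) (x e.1.1) * y e.1.2 + x e.1.2 * (starRingEnd ℂ) (y e.1.1)

section Coeff

variable {n : ℕ} {p : ℝ} {w : Fin n → ℝ} {Θ : Matrix (Fin n) (Fin n) ℝ}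

theorem skew_apply (hΘ : Θᵀ = -Θ) (i j : Fin n) : Θ j i = -Θ i j := by
  have := congrFun (congrFun hΘ i) j
  simpa using this

theorem noiseMatrix_swap (hΘ : Θᵀ = -Θ) (i j : Fin n) :
    noiseMatrix p w Θ j i = (starRingEnd ℂ) (noiseMatrix p w Θ i j) := by
  simp only [noiseMatrix, Matrix.of_apply]
  by_cases h : i = j
  · simp [h]
  · rw [if_neg h, if_neg (Ne.symm h), ← centredPhase_neg, skew_apply hΘ, neg_sub]

/-- The entries `(i, j)` and `(j, i)` are conjugate, so after taking real parts they merge into one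
coefficient times one phase. The result is a sum over the independent edges. -/
theorem re_inner_noise (hΘ : Θᵀ = -Θ) (x y : EuclideanSpace ℂ (Fin n)) :
    (inner ℂ x (Matrix.toEuclideanLin (noiseMatrix p w Θ) y)).re =
      ∑ e : {e : Fin n × Fin n // e.1 < e.2},
        (edgeCoeff x y e * centredPhase p (w e.1.1 - w e.1.2) (Θ e.1.1 e.1.2)).re := by
  have h1 : inner ℂ x (Matrix.toEuclideanLin (noiseMatrix p w Θ) y) =
      ∑ i, ∑ j, (starRingEnd ℂ) (x i) * noiseMatrix p w Θ i j * y j := by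
    simp only [PiLp.inner_apply, Matrix.ofLp_toLpLin, Matrix.toLin'_apply, Matrix.mulVec, dotProduct,
      RCLike.inner_apply, Finset.sum_mul]
    refine Finset.sum_congr rfl fun i _ => Finset.sum_congr rfl fun j _ => by ring
  rw [h1, sum_sum_eq_sum_edges _ (by intro i; simp [noiseMatrix]), Complex.re_sum]
  refine Finset.sum_congr rfl fun e _ => ?_
  rw [noiseMatrix_swap hΘ e.1.1 e.1.2]
  simp only [noiseMatrix, Matrix.of_apply, if_neg e.2.ne, edgeCoeff]
  generalize centredPhase p (w e.1.1 - w e.1.2) (Θ e.1.1 e.1.2) = ξ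
  have h2 : (starRingEnd ℂ) (x e.1.2) * (starRingEnd ℂ) ξ * y e.1.1 =
      (starRingEnd ℂ) (x e.1.2 * (starRingEnd ℂ) (y e.1.1) * ξ) := by simp; ring
  rw [h2, Complex.add_re, Complex.conj_re, ← Complex.add_re]
  congr 1
  ring

theorem sum_norm_edgeCoeff_sq_le (x y : EuclideanSpace ℂ (Fin n)) :
    ∑ e, ‖edgeCoeff x y e‖ ^ 2 ≤ 2 * (‖x‖ ^ 2 * ‖y‖ ^ 2) := by
  let F : Fin n → Fin n → ℝ := fun i j => if i = j then 0 else ‖x i‖ ^ 2 * ‖y j‖ ^ 2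
  calc ∑ e, ‖edgeCoeff x y e‖ ^ 2
      ≤ ∑ e : {e : Fin n × Fin n // e.1 < e.2}, 2 * (F e.1.1 e.1.2 + F e.1.2 e.1.1) := by
        refine Finset.sum_le_sum fun e _ => ?_
        simp only [F, if_neg e.2.ne, if_neg e.2.ne']
        have h := norm_add_le ((starRingEnd ℂ) (x e.1.1) * y e.1.2)
          (x e.1.2 * (starRingEnd ℂ) (y e.1.1))
        rw [norm_mul, norm_mul, RCLike.norm_conj, RCLike.norm_conj] at h
        calc ‖edgeCoeff x y e‖ ^ 2 ≤ (‖x e.1.1‖ * ‖y e.1.2‖ + ‖x e.1.2‖ * ‖y e.1.1‖) ^ 2 :=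
              pow_le_pow_left₀ (norm_nonneg _) h 2
          _ ≤ _ := by
              nlinarith [sq_nonneg (‖x e.1.1‖ * ‖y e.1.2‖ - ‖x e.1.2‖ * ‖y e.1.1‖)]
    _ = 2 * ∑ i, ∑ j, F i j := by
        rw [sum_sum_eq_sum_edges F (by simp [F]), Finset.mul_sum]
    _ ≤ 2 * ∑ i, ∑ j, ‖x i‖ ^ 2 * ‖y j‖ ^ 2 := by
        gcongr with i _ j _
        simp only [F]
        split_ifs
        · positivity
        · exact le_rfl
    _ = 2 * (‖x‖ ^ 2 * ‖y‖ ^ 2) := by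
        rw [EuclideanSpace.norm_sq_eq, EuclideanSpace.norm_sq_eq, Finset.sum_mul_sum]

/-- Bounds the effect of removing one edge from the form by `2 · 8 = 16`, the shift in the tail
bound for the noise norm. -/
theorem norm_edgeCoeff_le {x y : EuclideanSpace ℂ (Fin n)} (hx : ‖x‖ ≤ 2) (hy : ‖y‖ ≤ 2)
    (e : {e : Fin n × Fin n // e.1 < e.2}) : ‖edgeCoeff x y e‖ ≤ 8 := by
  have h := norm_add_le ((starRingEnd ℂ) (x e.1.1) * y e.1.2)
    (x e.1.2 * (starRingEnd ℂ) (y e.1.1))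
  rw [norm_mul, norm_mul, RCLike.norm_conj, RCLike.norm_conj] at h
  have hx' : ∀ i, ‖x i‖ ≤ 2 := fun i => (PiLp.norm_apply_le x i).trans hx
  have hy' : ∀ i, ‖y i‖ ≤ 2 := fun i => (PiLp.norm_apply_le y i).trans hy
  refine h.trans ?_
  have h1 := mul_le_mul (hx' e.1.1) (hy' e.1.2) (norm_nonneg _) (by norm_num)
  have h2 := mul_le_mul (hx' e.1.2) (hy' e.1.1) (norm_nonneg _) (by norm_num)
  linarith

end Coeff

end AttrSync

/-! ### Concentration and second moments of the noise -/

namespace AttrSync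

/-- The centred phase of the offset measured along an edge. -/
noncomputable def edgePhase {n : ℕ} (p : ℝ) (w : Fin n → ℝ) (Θ : Matrix (Fin n) (Fin n) ℝ)
    (e : {e : Fin n × Fin n // e.1 < e.2}) : ℂ :=
  centredPhase p (w e.1.1 - w e.1.2) (Θ e.1.1 e.1.2)

section Model

variable {n : ℕ} {Ω : Type*} [MeasurableSpace Ω] {μ : Measure Ω} {p : ℝ}
  {w : Fin n → ℝ} {Θ : Ω → Matrix (Fin n) (Fin n) ℝ}

theorem norm_mul_edgePhase_le (hp : 0 ≤ p) (hp' : p ≤ 1)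
    (c : ℂ) (A : Matrix (Fin n) (Fin n) ℝ) (e : {e : Fin n × Fin n // e.1 < e.2}) :
    ‖c * edgePhase p w A e‖ ≤ 2 * ‖c‖ := by
  rw [norm_mul, mul_comm]
  exact mul_le_mul_of_nonneg_right (norm_centredPhase_le hp hp' _ _) (norm_nonneg _)

theorem abs_re_mul_edgePhase_le (hp : 0 ≤ p) (hp' : p ≤ 1)
    (c : ℂ) (A : Matrix (Fin n) (Fin n) ℝ) (e : {e : Fin n × Fin n // e.1 < e.2}) :
    |(c * edgePhase p w A e).re| ≤ 2 * ‖c‖ :=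
  (Complex.abs_re_le_norm _).trans (norm_mul_edgePhase_le hp hp' c A e)

namespace IsNoisyOffsets

theorem aemeasurable_edgePhase (hΘ : IsNoisyOffsets μ p w Θ)
    (e : {e : Fin n × Fin n // e.1 < e.2}) :
    AEMeasurable (fun ω => edgePhase p w (Θ ω) e) μ :=
  (continuous_centredPhase p _).measurable.comp_aemeasurable (hΘ.law _ _ e.2).aemeasurable

theorem aemeasurable_re (hΘ : IsNoisyOffsets μ p w Θ) (c : ℂ)
    (e : {e : Fin n × Fin n // e.1 < e.2}) :
    AEMeasurable (fun ω => (c * edgePhase p w (Θ ω) e).re) μ :=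
  Complex.measurable_re.comp_aemeasurable ((hΘ.aemeasurable_edgePhase e).const_mul c)

theorem iIndepFun_re (hΘ : IsNoisyOffsets μ p w Θ)
    (c : {e : Fin n × Fin n // e.1 < e.2} → ℂ) :
    iIndepFun (fun e ω => (c e * edgePhase p w (Θ ω) e).re) μ :=
  hΘ.indep.comp (fun e t => (c e * centredPhase p (w e.1.1 - w e.1.2) t).re) fun _ =>
    (Complex.continuous_re.comp
      (continuous_const.mul (continuous_centredPhase p _))).measurable

theorem integrable_edgePhase [IsProbabilityMeasure μ] (hΘ : IsNoisyOffsets μ p w Θ)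
    (hp : 0 ≤ p) (hp' : p ≤ 1) (e : {e : Fin n × Fin n // e.1 < e.2}) :
    Integrable (fun ω => edgePhase p w (Θ ω) e) μ :=
  Integrable.of_bound (hΘ.aemeasurable_edgePhase e).aestronglyMeasurable 2
    (Filter.Eventually.of_forall fun _ => norm_centredPhase_le hp hp' _ _)

theorem integral_re [IsProbabilityMeasure μ] (hΘ : IsNoisyOffsets μ p w Θ)
    (hp : 0 ≤ p) (hp' : p ≤ 1) (c : ℂ) (e : {e : Fin n × Fin n // e.1 < e.2}) :
    ∫ ω, (c * edgePhase p w (Θ ω) e).re ∂μ = 0 := by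
  have h := _root_.integral_re ((hΘ.integrable_edgePhase hp hp' e).const_mul c)
  have h0 : ∫ ω, edgePhase p w (Θ ω) e ∂μ = 0 := integral_centredPhase hp (hΘ.law _ _ e.2)
  rw [integral_const_mul, h0] at h
  simpa using h

theorem hasSubgaussianMGF_re [IsProbabilityMeasure μ] (hΘ : IsNoisyOffsets μ p w Θ)
    (hp : 0 ≤ p) (hp' : p ≤ 1) (c : ℂ) (e : {e : Fin n × Fin n // e.1 < e.2}) :
    HasSubgaussianMGF (fun ω => (c * edgePhase p w (Θ ω) e).re) (4 * ‖c‖₊ ^ 2) μ := by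
  -- Hoeffding's lemma on an interval of length `4‖c‖`: the variance proxy is `(4‖c‖ / 2)²`.
  have h := hasSubgaussianMGF_of_mem_Icc_of_integral_eq_zero (a := -(2 * ‖c‖)) (b := 2 * ‖c‖)
    (hΘ.aemeasurable_re c e)
    (Filter.Eventually.of_forall fun ω => abs_le.1 (abs_re_mul_edgePhase_le hp hp' c _ e))
    (hΘ.integral_re hp hp' c e)
  convert h using 1
  ext
  push_cast
  rw [Real.norm_of_nonneg (by linarith [norm_nonneg c])]
  ring

/-- Sub-Gaussian parameters add over independent edges. The sum runs over a subset because one edge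
is later left out. -/
theorem measureReal_sum_ge_le [IsProbabilityMeasure μ] (hΘ : IsNoisyOffsets μ p w Θ)
    (hp : 0 ≤ p) (hp' : p ≤ 1) (c : {e : Fin n × Fin n // e.1 < e.2} → ℂ)
    (s : Finset {e : Fin n × Fin n // e.1 < e.2}) {S r : ℝ} (hS : ∑ e, ‖c e‖ ^ 2 ≤ S)
    (hr : 0 < r) :
    μ.real {ω | r ≤ ∑ e ∈ s, (c e * edgePhase p w (Θ ω) e).re} ≤ Real.exp (-r ^ 2 / (8 * S)) := by
  have hsub := HasSubgaussianMGF.sum_of_iIndepFun (hΘ.iIndepFun_re c) (s := s)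
    fun e _ => hΘ.hasSubgaussianMGF_re hp hp' (c e) e
  have hle : ((∑ e ∈ s, 4 * ‖c e‖₊ ^ 2 : NNReal) : ℝ) ≤ 4 * S := by
    push_cast
    rw [← Finset.mul_sum]
    gcongr
    exact (Finset.sum_le_univ_sum_of_nonneg fun e => by positivity).trans hS
  -- With proxy zero the Chernoff exponent is a division by zero, which Lean evaluates to `0`; there
  -- the sum vanishes almost surely instead.
  rcases eq_or_lt_of_le (NNReal.coe_nonneg (∑ e ∈ s, 4 * ‖c e‖₊ ^ 2 : NNReal)) with h0 | h0
  · have h00 : (∑ e ∈ s, 4 * ‖c e‖₊ ^ 2 : NNReal) = 0 := by exact_mod_cast h0.symm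
    rw [h00] at hsub
    have hae := hsub.ae_eq_zero_of_hasSubgaussianMGF_zero
    have : μ {ω | r ≤ ∑ e ∈ s, (c e * edgePhase p w (Θ ω) e).re} = 0 := by
      rw [measure_eq_zero_iff_ae_notMem]
      filter_upwards [hae] with ω hω hmem
      have h1 : r ≤ ∑ e ∈ s, (c e * edgePhase p w (Θ ω) e).re := hmem
      have h2 : ∑ e ∈ s, (c e * edgePhase p w (Θ ω) e).re = 0 := hω
      linarith
    rw [Measure.real, this]
    simpa using (Real.exp_pos _).le
  · refine (hsub.measure_ge_le hr.le).trans (Real.exp_le_exp.2 ?_)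
    rw [neg_div, neg_div, neg_le_neg_iff]
    refine div_le_div_of_nonneg_left (sq_nonneg r) (by linarith) (by linarith)

/-- Hoeffding's inequality on the event that a given offset is wrong. -/
theorem measureReal_sum_ge_and_ne_le [IsProbabilityMeasure μ] (hΘ : IsNoisyOffsets μ p w Θ)
    (hp : 0 ≤ p) (hp' : p ≤ 1) (c : {e : Fin n × Fin n // e.1 < e.2} → ℂ)
    {S r R : ℝ} (hS : ∑ e, ‖c e‖ ^ 2 ≤ S) (hr : R < r)
    (e : {e : Fin n × Fin n // e.1 < e.2}) (hR : 2 * ‖c e‖ ≤ R) :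
    μ.real {ω | r ≤ ∑ f, (c f * edgePhase p w (Θ ω) f).re ∧ Θ ω e.1.1 e.1.2 ≠ w e.1.1 - w e.1.2} ≤
      (1 - p) * Real.exp (-(r - R) ^ 2 / (8 * S)) := by
  classical
  let s := Finset.univ.erase e
  -- Leaving out `e` lowers the sum by at most `R`, and what remains is independent of whether the
  -- offset of `e` is wrong, so the probabilities multiply.
  have hind := hΘ.indep.indepFun_finset₀ s {e} (by simp [s])
    fun f => (hΘ.law _ _ f.2).aemeasurable
  let A : Set (s → ℝ) :=
    {y | r - R ≤ ∑ f : s, (c f * centredPhase p (w f.1.1.1 - w f.1.1.2) (y f)).re}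
  let B : Set (({e} : Finset {e : Fin n × Fin n // e.1 < e.2}) → ℝ) :=
    {y | y ⟨e, by simp⟩ ≠ w e.1.1 - w e.1.2}
  have hA : MeasurableSet A := by
    refine measurableSet_le measurable_const (Continuous.measurable ?_)
    refine continuous_finsetSum _ fun f _ => Complex.continuous_re.comp
      (continuous_const.mul ((continuous_centredPhase p _).comp (continuous_apply f)))
  have hB : MeasurableSet B :=
    measurableSet_eq_fun (measurable_pi_apply _) measurable_const |>.compl
  have hprod := hind.measure_inter_preimage_eq_mul A B hA hB
  have hAeq : (fun ω (f : s) => Θ ω f.1.1.1 f.1.1.2) ⁻¹' A =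
      {ω | r - R ≤ ∑ f ∈ s, (c f * edgePhase p w (Θ ω) f).re} := by
    ext ω
    simp only [A, Set.mem_preimage, Set.mem_ofPred_eq]
    rw [← Finset.sum_coe_sort s fun f => (c f * edgePhase p w (Θ ω) f).re]
    rfl
  have hsub : {ω | r ≤ ∑ f, (c f * edgePhase p w (Θ ω) f).re ∧
      Θ ω e.1.1 e.1.2 ≠ w e.1.1 - w e.1.2} ⊆
      (fun ω (f : s) => Θ ω f.1.1.1 f.1.1.2) ⁻¹' A ∩
      (fun ω (f : ({e} : Finset {e : Fin n × Fin n // e.1 < e.2})) =>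
        Θ ω f.1.1.1 f.1.1.2) ⁻¹' B := by
    rintro ω ⟨h1, h2⟩
    refine ⟨?_, h2⟩
    rw [hAeq]
    have h3 := Finset.add_sum_erase Finset.univ
      (fun f => (c f * edgePhase p w (Θ ω) f).re) (Finset.mem_univ e)
    have h4 := (abs_le.1 (abs_re_mul_edgePhase_le hp hp' (w := w) (c e) (Θ ω) e)).2
    simp only [Set.mem_ofPred_eq, s] at h1 ⊢
    linarith
  calc _ ≤ μ.real _ := measureReal_mono hsub
    _ = μ.real {ω | r - R ≤ ∑ f ∈ s, (c f * edgePhase p w (Θ ω) f).re} *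
        μ.real {ω | Θ ω e.1.1 e.1.2 ≠ w e.1.1 - w e.1.2} := by
        rw [Measure.real, hprod, ENNReal.toReal_mul, hAeq]
        rfl
    _ ≤ Real.exp (-(r - R) ^ 2 / (8 * S)) * (1 - p) := by
        gcongr
        · exact hΘ.measureReal_sum_ge_le hp hp' c s hS (by linarith)
        · exact measureReal_offset_ne_le hp' (hΘ.law _ _ e.2)
    _ = _ := mul_comm _ _

/-- The noise has small operator norm, except with exponentially small probability; on the event
that some offset is wrong the bound gains the factor `1 - p`. -/
theorem measureReal_noise_large_le [IsProbabilityMeasure μ] (hΘ : IsNoisyOffsets μ p w Θ)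
    (hp : 0 ≤ p) (hp' : p ≤ 1) {t : ℝ} (ht : 16 < t) :
    μ.real {ω | (∃ e : {e : Fin n × Fin n // e.1 < e.2}, Θ ω e.1.1 e.1.2 ≠ w e.1.1 - w e.1.2) ∧
      ¬ ∀ x, ‖Matrix.toEuclideanLin (noiseMatrix p w (Θ ω)) x‖ ≤ t * ‖x‖} ≤
      (n : ℝ) ^ 2 * 625 ^ n * ((1 - p) * Real.exp (-(t - 16) ^ 2 / 256)) := by
  classical
  obtain ⟨N, hcard, hN2, hN⟩ := exists_net (EuclideanSpace ℂ (Fin n))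
  -- The real dimension is `2n`, so the net has at most `25^n` points and there are at most `625^n`
  -- pairs; choosing the wrong edge costs the factor `n²`.
  rw [finrank_real_of_complex, finrank_euclideanSpace, Fintype.card_fin] at hcard
  let I := (Finset.univ : Finset {e : Fin n × Fin n // e.1 < e.2}) ×ˢ (N ×ˢ N)
  let D : ({e : Fin n × Fin n // e.1 < e.2} ×
      (EuclideanSpace ℂ (Fin n) × EuclideanSpace ℂ (Fin n))) → Set Ω := fun q =>
    {ω | t ≤ ∑ f, (edgeCoeff q.2.1 q.2.2 f * edgePhase p w (Θ ω) f).re ∧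
      Θ ω q.1.1.1 q.1.1.2 ≠ w q.1.1.1 - w q.1.1.2}
  have hsub : {ω | (∃ e : {e : Fin n × Fin n // e.1 < e.2},
      Θ ω e.1.1 e.1.2 ≠ w e.1.1 - w e.1.2) ∧
      ¬ ∀ x, ‖Matrix.toEuclideanLin (noiseMatrix p w (Θ ω)) x‖ ≤ t * ‖x‖} ⊆ ⋃ q ∈ I, D q := by
    rintro ω ⟨⟨e, he⟩, hω⟩
    by_contra hcon
    apply hω
    refine norm_apply_le_of_net hN _ fun x hx y hy => ?_
    by_contra! hlt
    apply hcon
    simp only [Set.mem_iUnion]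
    refine ⟨(e, x, y), by simp [I, hx, hy], ?_, he⟩
    rw [re_inner_noise (hΘ.skew ω)] at hlt
    exact hlt.le
  have hD : ∀ q ∈ I, μ.real (D q) ≤ (1 - p) * Real.exp (-(t - 16) ^ 2 / 256) := by
    rintro ⟨e, x, y⟩ hq
    simp only [I, Finset.mem_product, Finset.mem_univ, true_and] at hq
    have hx := hN2 x hq.1
    have hy := hN2 y hq.2
    -- Net points have norm at most `2`, whence `2 · 4 · 4 = 32` and the denominator `8 · 32 = 256`.
    have hS : ∑ e, ‖edgeCoeff x y e‖ ^ 2 ≤ 32 := by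
      refine (sum_norm_edgeCoeff_sq_le x y).trans ?_
      have h1 : ‖x‖ ^ 2 ≤ 2 ^ 2 := by gcongr
      have h2 : ‖y‖ ^ 2 ≤ 2 ^ 2 := by gcongr
      have h3 := mul_le_mul h1 h2 (sq_nonneg _) (by norm_num)
      linarith
    have := hΘ.measureReal_sum_ge_and_ne_le hp hp' (edgeCoeff x y) hS ht e
      (by linarith [norm_edgeCoeff_le hx hy e])
    rwa [show (8 : ℝ) * 32 = 256 by norm_num] at this
  have hcE : (Fintype.card {e : Fin n × Fin n // e.1 < e.2} : ℝ) ≤ (n : ℝ) ^ 2 := by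
    have := Fintype.card_subtype_le (fun e : Fin n × Fin n => e.1 < e.2)
    rw [Fintype.card_prod, Fintype.card_fin] at this
    rw [sq]
    exact_mod_cast this
  have hcN : (N.card : ℝ) * N.card ≤ 625 ^ n := by
    have h1 : (N.card : ℝ) ≤ 25 ^ n := by
      rw [pow_mul] at hcard
      exact_mod_cast hcard
    calc (N.card : ℝ) * N.card ≤ 25 ^ n * 25 ^ n := by gcongr
      _ = 625 ^ n := by rw [← mul_pow]; norm_num
  have hnn : 0 ≤ (1 - p) * Real.exp (-(t - 16) ^ 2 / 256) :=
    mul_nonneg (by linarith) (Real.exp_pos _).le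
  calc _ ≤ μ.real (⋃ q ∈ I, D q) := measureReal_mono hsub (measure_ne_top _ _)
    _ ≤ ∑ q ∈ I, μ.real (D q) := measureReal_biUnion_finset_le _ _
    _ ≤ ∑ q ∈ I, (1 - p) * Real.exp (-(t - 16) ^ 2 / 256) := Finset.sum_le_sum hD
    _ = (I.card : ℝ) * ((1 - p) * Real.exp (-(t - 16) ^ 2 / 256)) := by
        rw [Finset.sum_const, nsmul_eq_mul]
    _ ≤ _ := by
        refine mul_le_mul_of_nonneg_right ?_ hnn
        simp only [I, Finset.card_product, Finset.card_univ]
        push_cast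
        gcongr

/-- The second moment of a real linear functional of the noise. -/
theorem integral_re_inner_noise_sq_le [IsProbabilityMeasure μ] (hΘ : IsNoisyOffsets μ p w Θ)
    (hp : 0 ≤ p) (hp' : p ≤ 1) (x y : EuclideanSpace ℂ (Fin n)) :
    ∫ ω, (inner ℂ x (Matrix.toEuclideanLin (noiseMatrix p w (Θ ω)) y)).re ^ 2 ∂μ ≤
      2 * (‖x‖ ^ 2 * ‖y‖ ^ 2) * (1 - p ^ 2) := by
  have hnn : 0 ≤ 1 - p ^ 2 := by nlinarith
  let Y : {e : Fin n × Fin n // e.1 < e.2} → Ω → ℝ := fun e ω =>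
    (edgeCoeff x y e * edgePhase p w (Θ ω) e).re
  have hY := integral_norm_sum_sq (μ := μ) Finset.univ Y (∑ e, 2 * ‖edgeCoeff x y e‖)
    (fun e _ => hΘ.aemeasurable_re _ e)
    (fun e _ ω => (abs_re_mul_edgePhase_le hp hp' _ _ e).trans
      (Finset.single_le_sum (f := fun e => 2 * ‖edgeCoeff x y e‖)
        (fun e _ => by positivity) (Finset.mem_univ e)))
    (fun e _ => hΘ.integral_re hp hp' _ e)
    (fun e _ f _ hef => (hΘ.iIndepFun_re (edgeCoeff x y)).indepFun hef)
  have h1 : ∀ ω, (inner ℂ x (Matrix.toEuclideanLin (noiseMatrix p w (Θ ω)) y)).re ^ 2 =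
      ‖∑ e, Y e ω‖ ^ 2 := fun ω => by
    rw [re_inner_noise (hΘ.skew ω), Real.norm_eq_abs, sq_abs]
    rfl
  simp only [h1]
  rw [hY]
  have h2 : ∀ e, ∫ ω, ‖Y e ω‖ ^ 2 ∂μ ≤ ‖edgeCoeff x y e‖ ^ 2 * (1 - p ^ 2) := fun e => by
    have hsq : ∫ ω, ‖edgePhase p w (Θ ω) e‖ ^ 2 ∂μ = 1 - p ^ 2 :=
      integral_norm_centredPhase_sq hp (hΘ.law _ _ e.2)
    rw [← hsq, ← integral_const_mul]
    refine integral_mono_of_nonneg (Filter.Eventually.of_forall fun ω => by positivity) ?_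
      (Filter.Eventually.of_forall fun ω => ?_)
    · refine Integrable.const_mul (Integrable.of_bound
        ((hΘ.aemeasurable_edgePhase e).norm.pow_const 2).aestronglyMeasurable (2 ^ 2)
        (Filter.Eventually.of_forall fun ω => ?_)) _
      rw [norm_pow, norm_norm]
      gcongr
      exact norm_centredPhase_le hp hp' _ _
    · simp only [Y]
      rw [← mul_pow, ← norm_mul]
      gcongr
      exact Complex.abs_re_le_norm _
  calc ∑ e, ∫ ω, ‖Y e ω‖ ^ 2 ∂μ ≤ ∑ e, ‖edgeCoeff x y e‖ ^ 2 * (1 - p ^ 2) :=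
        Finset.sum_le_sum fun e _ => h2 e
    _ = (∑ e, ‖edgeCoeff x y e‖ ^ 2) * (1 - p ^ 2) := by rw [Finset.sum_mul]
    _ ≤ _ := by gcongr; exact sum_norm_edgeCoeff_sq_le x y

/-- Here `g` is the identity above the diagonal and conjugation below it. Its listed properties let
both cases be treated at once. -/
theorem exists_edge (hΘ : IsNoisyOffsets μ p w Θ) {i j : Fin n} (hij : i ≠ j) :
    ∃ (e : {e : Fin n × Fin n // e.1 < e.2}) (g : ℂ → ℂ), Continuous g ∧ (∀ c, ‖g c‖ = ‖c‖) ∧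
      (∀ f : Ω → ℂ, ∫ ω, f ω ∂μ = 0 → ∫ ω, g (f ω) ∂μ = 0) ∧
      (e.1 = (i, j) ∨ e.1 = (j, i)) ∧
      ∀ ω, noiseMatrix p w (Θ ω) i j = g (edgePhase p w (Θ ω) e) := by
  rcases lt_or_gt_of_ne hij with h | h
  · exact ⟨⟨(i, j), h⟩, id, continuous_id, fun _ => rfl, fun _ h => h, Or.inl rfl,
      fun ω => by simp [noiseMatrix, hij, edgePhase]⟩
  · refine ⟨⟨(j, i), h⟩, starRingEnd ℂ, Complex.continuous_conj, fun c => RCLike.norm_conj c,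
      fun f hf => by rw [integral_conj, hf, map_zero], Or.inr rfl, fun ω => ?_⟩
    rw [noiseMatrix_swap (hΘ.skew ω) j i]
    simp [noiseMatrix, hij.symm, edgePhase]

theorem aemeasurable_noiseMatrix (hΘ : IsNoisyOffsets μ p w Θ) (i j : Fin n) :
    AEMeasurable (fun ω => noiseMatrix p w (Θ ω) i j) μ := by
  by_cases hij : i = j
  · simp [noiseMatrix, hij]
  · obtain ⟨e, g, hg, -, -, -, he⟩ := hΘ.exists_edge hij
    simp only [he]
    exact hg.measurable.comp_aemeasurable (hΘ.aemeasurable_edgePhase e)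

/-- Two off-diagonal entries of one row lie on different edges, so a row is a sum of pairwise
independent terms despite the Hermitian symmetry. -/
theorem indepFun_noiseMatrix (hΘ : IsNoisyOffsets μ p w Θ) {i j k : Fin n} (hij : i ≠ j)
    (hik : i ≠ k) (hjk : j ≠ k) :
    IndepFun (fun ω => noiseMatrix p w (Θ ω) i j) (fun ω => noiseMatrix p w (Θ ω) i k) μ := by
  obtain ⟨e, g, hg, -, -, heij, he⟩ := hΘ.exists_edge hij
  obtain ⟨f, h, hh, -, -, hfik, hf⟩ := hΘ.exists_edge hik
  have hef : e ≠ f := by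
    rintro rfl
    rcases heij with h1 | h1 <;> rcases hfik with h2 | h2 <;> rw [h1, Prod.mk.injEq] at h2
    · exact hjk h2.2
    · exact hik h2.1
    · exact hij h2.1.symm
    · exact hjk h2.1
  simp only [he, hf]
  exact (hΘ.indep.indepFun hef).comp
    (hg.comp (continuous_centredPhase p _)).measurable
    (hh.comp (continuous_centredPhase p _)).measurable

theorem norm_noiseMatrix_le (hp : 0 ≤ p) (hp' : p ≤ 1) (A : Matrix (Fin n) (Fin n) ℝ)
    (i j : Fin n) : ‖noiseMatrix p w A i j‖ ≤ 2 := by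
  by_cases hij : i = j
  · simp [noiseMatrix, hij]
  · simp only [noiseMatrix, Matrix.of_apply, if_neg hij]
    exact norm_centredPhase_le hp hp' _ _

/-- The second moment of the noise applied to a vector with entries of equal modulus. -/
theorem integral_norm_noise_sq [IsProbabilityMeasure μ] (hΘ : IsNoisyOffsets μ p w Θ)
    (hp : 0 ≤ p) (hp' : p ≤ 1) {y : EuclideanSpace ℂ (Fin n)} {κ : ℝ} (hy : ∀ i, ‖y i‖ = κ) :
    ∫ ω, ‖Matrix.toEuclideanLin (noiseMatrix p w (Θ ω)) y‖ ^ 2 ∂μ =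
      n * ((n - 1) * (κ ^ 2 * (1 - p ^ 2))) := by
  classical
  have hrow : ∀ ω i, Matrix.toEuclideanLin (noiseMatrix p w (Θ ω)) y i =
      ∑ j ∈ Finset.univ.erase i, noiseMatrix p w (Θ ω) i j * y j := fun ω i => by
    rw [Matrix.ofLp_toLpLin, Matrix.toLin'_apply, Matrix.mulVec, dotProduct,
      ← Finset.add_sum_erase _ _ (Finset.mem_univ i)]
    simp [noiseMatrix]
  -- For `n = 0` the hypothesis on `κ` is void, so its sign is only known given an index.
  have hκ : ∀ i : Fin n, 0 ≤ κ := fun i => hy i ▸ norm_nonneg _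
  have hmeas : ∀ i j, AEMeasurable (fun ω => noiseMatrix p w (Θ ω) i j * y j) μ :=
    fun i j => (hΘ.aemeasurable_noiseMatrix i j).mul_const _
  have hbd : ∀ i j ω, ‖noiseMatrix p w (Θ ω) i j * y j‖ ≤ 2 * κ := fun i j ω => by
    rw [norm_mul, hy]
    exact mul_le_mul_of_nonneg_right (norm_noiseMatrix_le hp hp' _ _ _) (hκ i)
  have hrowint : ∀ i, ∫ ω, ‖Matrix.toEuclideanLin (noiseMatrix p w (Θ ω)) y i‖ ^ 2 ∂μ =
      (n - 1) * (κ ^ 2 * (1 - p ^ 2)) := fun i => by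
    simp only [hrow]
    rw [integral_norm_sum_sq (μ := μ) (Finset.univ.erase i)
      (fun j ω => noiseMatrix p w (Θ ω) i j * y j) (2 * κ) (fun j _ => hmeas i j)
      (fun j _ ω => hbd i j ω)]
    · have hterm : ∀ j ∈ Finset.univ.erase i,
          ∫ ω, ‖noiseMatrix p w (Θ ω) i j * y j‖ ^ 2 ∂μ = κ ^ 2 * (1 - p ^ 2) := fun j hj => by
        obtain ⟨e, g, -, hgn, -, -, he⟩ := hΘ.exists_edge (Finset.ne_of_mem_erase hj).symm
        have hsq : ∫ ω, ‖edgePhase p w (Θ ω) e‖ ^ 2 ∂μ = 1 - p ^ 2 :=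
          integral_norm_centredPhase_sq hp (hΘ.law _ _ e.2)
        simp only [norm_mul, he, hgn, hy, mul_pow]
        rw [integral_mul_const, hsq, mul_comm]
      rw [Finset.sum_congr rfl hterm, Finset.sum_const, Finset.card_erase_of_mem
        (Finset.mem_univ i), Finset.card_univ, Fintype.card_fin, nsmul_eq_mul,
        Nat.cast_sub (Nat.one_le_of_lt i.2), Nat.cast_one]
    · intro j hj
      obtain ⟨e, g, -, -, hg0, -, he⟩ := hΘ.exists_edge (Finset.ne_of_mem_erase hj).symm
      rw [integral_mul_const]
      simp only [he]
      rw [hg0 (fun ω => edgePhase p w (Θ ω) e) (integral_centredPhase hp (hΘ.law _ _ e.2)), zero_mul]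
    · intro j hj k hk hjk
      exact (hΘ.indepFun_noiseMatrix (Finset.ne_of_mem_erase hj).symm
        (Finset.ne_of_mem_erase hk).symm hjk).comp (measurable_mul_const (y j))
        (measurable_mul_const (y k))
  simp only [EuclideanSpace.norm_sq_eq]
  rw [integral_finsetSum]
  · simp only [hrowint]
    simp
  · intro i _
    refine Integrable.of_bound ?_ ((∑ j ∈ Finset.univ.erase i, 2 * κ) ^ 2)
      (Filter.Eventually.of_forall fun ω => ?_)
    · simp only [hrow]
      exact ((Finset.aemeasurable_fun_sum _ fun j _ => hmeas i j).norm.pow_const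
        2).aestronglyMeasurable
    · rw [norm_pow, norm_norm, hrow]
      gcongr
      exact norm_sum_le_of_le _ fun j _ => hbd i j ω

end IsNoisyOffsets

end Model

end AttrSync

/-! ### The angle for a fixed matrix of offsets -/

namespace AttrSync

section Deterministic

variable {n : ℕ} {p : ℝ} {w : Fin n → ℝ} {Θ : Matrix (Fin n) (Fin n) ℝ}

theorem norm_trueVector_apply (w : Fin n → ℝ) (i : Fin n) :
    ‖trueVector w i‖ = 1 / Real.sqrt n := by
  simp only [trueVector, norm_div, norm_exp_I_mul, Complex.norm_real, Real.norm_eq_abs,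
    abs_of_nonneg (Real.sqrt_nonneg _)]

theorem norm_trueVector (hn : 0 < n) (w : Fin n → ℝ) : ‖trueVector w‖ = 1 := by
  have hn' : (0 : ℝ) < n := Nat.cast_pos.2 hn
  rw [EuclideanSpace.norm_eq, Real.sqrt_eq_one]
  simp only [norm_trueVector_apply, div_pow, one_pow, Real.sq_sqrt hn'.le]
  simp [hn'.ne']

theorem exp_sub_eq_trueVector (hn : 0 < n) (w : Fin n → ℝ) (i j : Fin n) :
    Complex.exp (Complex.I * ((w i - w j : ℝ) : ℂ)) =
      n * (trueVector w i * (starRingEnd ℂ) (trueVector w j)) := by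
  have hn' : (0 : ℝ) < n := Nat.cast_pos.2 hn
  have hs : (Real.sqrt n : ℂ) * (Real.sqrt n : ℂ) = n := by
    rw [← Complex.ofReal_mul, Real.mul_self_sqrt hn'.le]; simp
  have hs0 : (Real.sqrt n : ℂ) ≠ 0 := by
    simpa using hn.ne'
  simp only [trueVector, map_div₀, ← Complex.exp_conj, map_mul, Complex.conj_I,
    Complex.conj_ofReal]
  rw [div_mul_div_comm, hs, ← Complex.exp_add, mul_div_cancel₀ _ (by exact_mod_cast hn'.ne')]
  congr 1
  push_cast
  ring

theorem phaseMatrix_diag (hΘ : Θᵀ = -Θ) (i : Fin n) : phaseMatrix Θ i i = 1 := by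
  have h : Θ i i = 0 := by linarith [skew_apply hΘ i i]
  simp [phaseMatrix, h]

theorem isHermitian_phaseMatrix (hΘ : Θᵀ = -Θ) : (phaseMatrix Θ).IsHermitian := by
  ext i j
  simp only [phaseMatrix, Matrix.conjTranspose_apply, Matrix.of_apply]
  rw [skew_apply hΘ i j, RCLike.star_def, ← Complex.exp_conj]
  simp

/-- The phase matrix is a multiple of the projection on the true vector, plus a multiple of the
identity, plus the noise. -/
theorem phaseMatrix_apply (hn : 0 < n) (hΘ : Θᵀ = -Θ) (p : ℝ) (w : Fin n → ℝ)
    (x : EuclideanSpace ℂ (Fin n)) :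
    Matrix.toEuclideanLin (phaseMatrix Θ) x =
      (((n * p : ℝ) : ℂ) * inner ℂ (trueVector w) x) • trueVector w + ((1 - p : ℝ) : ℂ) • x +
        Matrix.toEuclideanLin (noiseMatrix p w Θ) x := by
  have hentry : ∀ i j, phaseMatrix Θ i j =
      ((n * p : ℝ) : ℂ) * (trueVector w i * (starRingEnd ℂ) (trueVector w j)) +
        ((1 - p : ℝ) : ℂ) * (if i = j then 1 else 0) + noiseMatrix p w Θ i j := fun i j => by
    have h := exp_sub_eq_trueVector hn w i j
    -- On the diagonal the phase is `1` and the noise is `0`; the rank-one part gives `p`, which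
    -- leaves `1 - p` for the identity.
    by_cases hij : i = j
    · subst hij
      rw [phaseMatrix_diag hΘ]
      simp only [sub_self, Complex.ofReal_zero, mul_zero, Complex.exp_zero] at h
      simp only [noiseMatrix, Matrix.of_apply, if_true]
      push_cast
      linear_combination (p : ℂ) * h
    · simp only [noiseMatrix, phaseMatrix, Matrix.of_apply, if_neg hij, centredPhase, h]
      push_cast
      ring
  ext i
  simp only [PiLp.add_apply, PiLp.smul_apply, Matrix.ofLp_toLpLin, Matrix.toLin'_apply,
    Matrix.mulVec, dotProduct, hentry, PiLp.inner_apply, RCLike.inner_apply, smul_eq_mul,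
    add_mul, Finset.sum_add_distrib, Finset.mul_sum, Finset.sum_mul]
  congr 1
  congr 1
  · exact Finset.sum_congr rfl fun j _ => by ring
  · simp

/-- Without wrong offsets the phase matrix is a multiple of the projection on the true vector. -/
theorem phaseMatrix_apply_of_correct (hn : 0 < n) (hΘ : Θᵀ = -Θ)
    (h : ∀ e : {e : Fin n × Fin n // e.1 < e.2}, Θ e.1.1 e.1.2 = w e.1.1 - w e.1.2)
    (x : EuclideanSpace ℂ (Fin n)) :
    Matrix.toEuclideanLin (phaseMatrix Θ) x =
      ((n : ℂ) * inner ℂ (trueVector w) x) • trueVector w := by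
  have hall : ∀ i j, Θ i j = w i - w j := fun i j => by
    rcases lt_trichotomy i j with hij | rfl | hij
    · exact h ⟨(i, j), hij⟩
    · linarith [skew_apply hΘ i i]
    · rw [skew_apply hΘ j i, h ⟨(j, i), hij⟩]; ring
  ext i
  simp only [PiLp.smul_apply, Matrix.ofLp_toLpLin, Matrix.toLin'_apply, Matrix.mulVec, dotProduct,
    phaseMatrix, Matrix.of_apply, hall, exp_sub_eq_trueVector hn w, PiLp.inner_apply,
    RCLike.inner_apply, smul_eq_mul, Finset.mul_sum, Finset.sum_mul]
  exact Finset.sum_congr rfl fun j _ => by ring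

theorem correlation_nonneg (z v : EuclideanSpace ℂ (Fin n)) : 0 ≤ correlation z v := by
  unfold correlation; positivity

theorem correlation_le_one (z v : EuclideanSpace ℂ (Fin n)) : correlation z v ≤ 1 :=
  div_le_one_of_le₀ (norm_inner_le_norm z v) (by positivity)

theorem cos_angle (z v : EuclideanSpace ℂ (Fin n)) : Real.cos (angle z v) = correlation z v :=
  Real.cos_arccos (by linarith [correlation_nonneg z v]) (correlation_le_one z v)

theorem sin_angle_sq (z v : EuclideanSpace ℂ (Fin n)) :
    Real.sin (angle z v) ^ 2 = 1 - correlation z v ^ 2 := by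
  rw [Real.sin_sq, cos_angle]

/-- A crude sure bound, needed for integrability and to bound `noiseRatio` on the failure event. -/
theorem norm_noise_trueVector_sq_le (hp : 0 ≤ p) (hp' : p ≤ 1) (hn : 0 < n)
    (Θ : Matrix (Fin n) (Fin n) ℝ) :
    ‖Matrix.toEuclideanLin (noiseMatrix p w Θ) (trueVector w)‖ ^ 2 ≤ 4 * (n : ℝ) ^ 2 := by
  have hn' : (0 : ℝ) < n := Nat.cast_pos.2 hn
  rw [EuclideanSpace.norm_sq_eq]
  have hrow : ∀ i, ‖Matrix.toEuclideanLin (noiseMatrix p w Θ) (trueVector w) i‖ ^ 2 ≤ 4 * n :=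
    fun i => by
    have h1 : ‖Matrix.toEuclideanLin (noiseMatrix p w Θ) (trueVector w) i‖ ≤
        ∑ _j : Fin n, 2 * (1 / Real.sqrt n) := by
      simp only [Matrix.ofLp_toLpLin, Matrix.toLin'_apply, Matrix.mulVec, dotProduct]
      refine norm_sum_le_of_le _ fun j _ => ?_
      rw [norm_mul, norm_trueVector_apply]
      gcongr
      exact IsNoisyOffsets.norm_noiseMatrix_le hp hp' _ _ _
    calc _ ≤ (∑ _j : Fin n, 2 * (1 / Real.sqrt n)) ^ 2 := by gcongr
      _ = 4 * n := by
        simp only [Finset.sum_const, Finset.card_univ, Fintype.card_fin, nsmul_eq_mul, mul_pow,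
          div_pow, one_pow, Real.sq_sqrt hn'.le]
        field_simp
        norm_num
  calc _ ≤ ∑ _i : Fin n, 4 * (n : ℝ) := Finset.sum_le_sum fun i _ => hrow i
    _ = 4 * (n : ℝ) ^ 2 := by simp; ring

/-- The squared ratio that governs the angle between the top eigenvector and the true vector. -/
noncomputable def noiseRatio (p : ℝ) (w : Fin n → ℝ) (Θ : Matrix (Fin n) (Fin n) ℝ) : ℝ :=
  ‖perp (trueVector w) (Matrix.toEuclideanLin (noiseMatrix p w Θ) (trueVector w))‖ ^ 2 /
    (n * p) ^ 2

theorem noiseRatio_nonneg : 0 ≤ noiseRatio p w Θ := by unfold noiseRatio; positivity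

theorem noiseRatio_le (hp : 0 < p) (hp' : p ≤ 1) (hn : 0 < n) : noiseRatio p w Θ ≤ 4 / p ^ 2 := by
  have hn' : (0 : ℝ) < n := Nat.cast_pos.2 hn
  unfold noiseRatio
  calc _ ≤ 4 * (n : ℝ) ^ 2 / (n * p) ^ 2 := by
        gcongr
        refine le_trans ?_ (norm_noise_trueVector_sq_le hp.le hp' hn Θ (w := w))
        gcongr
        exact norm_perp_le (norm_trueVector hn w) _
    _ = 4 / p ^ 2 := by field_simp

/-- The alternative in `hgood` is essential: with all offsets correct `W` need not be small, but `z`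
is then an exact eigenvector of `H`, and both orthogonal components vanish. -/
theorem IsTopEigenvector.components {v : EuclideanSpace ℂ (Fin n)}
    (hv : IsTopEigenvector (phaseMatrix Θ) v) (hn : 0 < n) (hp : 0 < p) (hΘ : Θᵀ = -Θ) {δ : ℝ}
    (hδ : 0 ≤ δ)
    (hgood : (∀ e : {e : Fin n × Fin n // e.1 < e.2}, Θ e.1.1 e.1.2 = w e.1.1 - w e.1.2) ∨
      ∀ x, ‖Matrix.toEuclideanLin (noiseMatrix p w Θ) x‖ ≤ δ * (n * p) * ‖x‖) :
    ‖perp (trueVector w) (Matrix.toEuclideanLin (noiseMatrix p w Θ) (trueVector w))‖ ≤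
      δ * (n * p) ∧
    n * p * (1 - 2 * δ) * ‖perp (trueVector w) v‖ ≤ ‖inner ℂ (trueVector w) v‖ *
      ‖perp (trueVector w) (Matrix.toEuclideanLin (noiseMatrix p w Θ) (trueVector w))‖ ∧
    ‖inner ℂ (trueVector w) v‖ *
      ‖perp (trueVector w) (Matrix.toEuclideanLin (noiseMatrix p w Θ) (trueVector w))‖ ≤
      n * p * (1 + 2 * δ) * ‖perp (trueVector w) v‖ := by
  have hn' : (0 : ℝ) < n := Nat.cast_pos.2 hn
  obtain ⟨l, hl, hHv, hnorm⟩ := hv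
  set z := trueVector w with hzdef
  have hz : ‖z‖ = 1 := norm_trueVector hn w
  have hHv' : Matrix.toEuclideanLin (phaseMatrix Θ) v = (l : ℂ) • v := by
    ext i
    have := congrFun hHv i
    rw [Matrix.ofLp_toLpLin, Matrix.toLin'_apply, this]
    rfl
  have hzl := re_inner_le_of_isGreatest (isHermitian_phaseMatrix hΘ) hl z
  have hzz : inner ℂ z z = 1 := by rw [inner_self_eq_norm_sq_to_K, hz]; simp
  rw [hz, one_pow, mul_one] at hzl
  have hv0 : v ≠ 0 := by
    rintro rfl
    rw [norm_zero] at hnorm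
    linarith
  rcases hgood with hc | hsmall
  · rw [phaseMatrix_apply_of_correct hn hΘ hc, ← hzdef, hzz, mul_one, inner_smul_right, hzz,
      mul_one, Complex.natCast_re] at hzl
    rw [phaseMatrix_apply_of_correct hn hΘ hc, ← hzdef] at hHv'
    have hpv : perp z v = 0 := by
      have h := congrArg (perp z) hHv'
      rw [perp_smul, perp_smul, perp_self hz, smul_zero] at h
      refine (smul_eq_zero.1 h.symm).resolve_left ?_
      exact_mod_cast (hn'.trans_le hzl).ne'
    have hTz : perp z (Matrix.toEuclideanLin (noiseMatrix p w Θ) z) = 0 := by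
      have h := congrArg (perp z) ((phaseMatrix_apply hn hΘ p w z).symm.trans
        (phaseMatrix_apply_of_correct hn hΘ hc z))
      rw [← hzdef, perp_add, perp_add, perp_smul, perp_smul, perp_smul, perp_self hz] at h
      simpa using h
    rw [hpv, hTz]
    simp only [norm_zero, mul_zero, le_refl, and_self, and_true]
    positivity
  · refine ⟨(norm_perp_le hz _).trans (by simpa [hz] using hsmall z), ?_⟩
    -- The term `(1 - p) I` only shifts the eigenvalue.
    refine eigenvector_components hz _ (m := l - (1 - p)) hsmall hv0 (by positivity) ?_ ?_
    · rw [phaseMatrix_apply hn hΘ p w] at hHv'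
      rw [Complex.ofReal_sub, sub_smul, ← hHv']
      abel
    · rw [phaseMatrix_apply hn hΘ p w, ← hzdef, hzz, inner_add_right, inner_add_right,
        inner_smul_right, inner_smul_right, hzz, mul_one, mul_one, mul_one, Complex.add_re,
        Complex.add_re, Complex.ofReal_re, Complex.ofReal_re] at hzl
      linarith

/-- The squared sine and the truncated squared tangent of the angle are both close to
`noiseRatio`. -/
theorem IsTopEigenvector.close_to_noiseRatio {v : EuclideanSpace ℂ (Fin n)}
    (hv : IsTopEigenvector (phaseMatrix Θ) v) (hn : 0 < n) (hp : 0 < p) (hΘ : Θᵀ = -Θ) {δ : ℝ}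
    (hδ : 0 ≤ δ) (hδ' : δ ≤ 1 / 10)
    (hgood : (∀ e : {e : Fin n × Fin n // e.1 < e.2}, Θ e.1.1 e.1.2 = w e.1.1 - w e.1.2) ∨
      ∀ x, ‖Matrix.toEuclideanLin (noiseMatrix p w Θ) x‖ ≤ δ * (n * p) * ‖x‖) :
    |(1 - correlation (trueVector w) v ^ 2) - noiseRatio p w Θ| ≤ 8 * δ * noiseRatio p w Θ ∧
    ∀ K : ℝ, 1 ≤ K →
      |(min (tanSq (angle (trueVector w) v)) (ENNReal.ofReal K)).toReal - noiseRatio p w Θ| ≤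
        8 * δ * noiseRatio p w Θ := by
  have hn' : (0 : ℝ) < n := Nat.cast_pos.2 hn
  obtain ⟨h1, h2, h3⟩ := hv.components hn hp hΘ hδ hgood
  have hz : ‖trueVector w‖ = 1 := norm_trueVector hn w
  have hvn : ‖v‖ ^ 2 = n := by obtain ⟨_, _, _, h⟩ := hv; exact h
  have hperp := norm_perp_sq hz v
  have hV : ‖inner ℂ (trueVector w) v‖ ^ 2 + ‖perp (trueVector w) v‖ ^ 2 = n := by
    rw [hperp, hvn]; ring
  obtain ⟨ha, r1, r2, r3⟩ := ratio_bounds (norm_nonneg _) (norm_nonneg _) (norm_nonneg _)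
    (by positivity : 0 < (n : ℝ) * p) hδ' (by rw [hV]; exact hn') h1 h2 h3
  set a := ‖inner ℂ (trueVector w) v‖ with hadef
  set β := ‖perp (trueVector w) v‖ with hβdef
  have hcorr : correlation (trueVector w) v ^ 2 = a ^ 2 / n := by
    rw [correlation, hz, one_mul, div_pow, hvn]
  have hsin : 1 - correlation (trueVector w) v ^ 2 = β ^ 2 / (a ^ 2 + β ^ 2) := by
    rw [hcorr, hV]
    field_simp
    linarith
  refine ⟨by rw [hsin]; exact r3, fun K hK => ?_⟩
  have htan : tanSq (angle (trueVector w) v) = ENNReal.ofReal (β ^ 2 / a ^ 2) := by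
    rw [tanSq, sin_angle_sq, cos_angle, ← ENNReal.ofReal_div_of_pos (by rw [hcorr]; positivity),
      hsin, hcorr, hV]
    congr 1
    field_simp
  -- Here `tan² ≤ 1 ≤ K`, so the truncation is inactive.
  rw [htan, min_eq_left (ENNReal.ofReal_le_ofReal (r1.trans hK)),
    ENNReal.toReal_ofReal (by positivity)]
  exact r2

end Deterministic

/-! ### Comparing integrals up to an exceptional set -/

section Comparison

variable {Ω : Type*} [MeasurableSpace Ω] {μ : Measure Ω} [IsProbabilityMeasure μ]

theorem abs_integral_sub_le {f g : Ω → ℝ} {B : Set Ω} {K C η : ℝ}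
    (hf : AEMeasurable f μ) (hg : AEMeasurable g μ)
    (hf0 : ∀ ω, 0 ≤ f ω) (hfK : ∀ ω, f ω ≤ K) (hg0 : ∀ ω, 0 ≤ g ω) (hgC : ∀ ω, g ω ≤ C)
    (hη : 0 ≤ η) (hfg : ∀ᵐ ω ∂μ, ω ∉ B → |f ω - g ω| ≤ η * g ω) :
    |∫ ω, f ω ∂μ - ∫ ω, g ω ∂μ| ≤ η * ∫ ω, g ω ∂μ + (K + C) * μ.real B := by
  have hfi : Integrable f μ := Integrable.of_bound hf.aestronglyMeasurable K
    (Filter.Eventually.of_forall fun ω => by rw [Real.norm_of_nonneg (hf0 ω)]; exact hfK ω)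
  have hgi : Integrable g μ := Integrable.of_bound hg.aestronglyMeasurable C
    (Filter.Eventually.of_forall fun ω => by rw [Real.norm_of_nonneg (hg0 ω)]; exact hgC ω)
  -- `B` is not assumed measurable; its measurable hull has the same measure.
  let B' := toMeasurable μ B
  have hB' : MeasurableSet B' := measurableSet_toMeasurable μ B
  have hind : Integrable (B'.indicator fun _ => K + C) μ := (integrable_const _).indicator hB'
  rw [← integral_sub hfi hgi]
  refine (abs_integral_le_integral_abs).trans ?_
  have hval : ∫ ω, (η * g ω + B'.indicator (fun _ => K + C) ω) ∂μ =
      η * ∫ ω, g ω ∂μ + (K + C) * μ.real B := by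
    rw [integral_add (hgi.const_mul η) hind, integral_const_mul, integral_indicator_const _ hB',
      smul_eq_mul, mul_comm (K + C)]
    congr 2
    simp [B', Measure.real, measure_toMeasurable]
  rw [← hval]
  refine integral_mono_ae (hfi.sub hgi).abs ((hgi.const_mul η).add hind) ?_
  filter_upwards [hfg] with ω hω
  by_cases hmem : ω ∈ B'
  · simp only [Set.indicator_of_mem hmem]
    have := mul_nonneg hη (hg0 ω)
    exact abs_le.2 ⟨by linarith [hf0 ω, hg0 ω, hgC ω, hfK ω], by linarith [hf0 ω, hg0 ω, hgC ω, hfK ω]⟩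
  · simp only [Set.indicator_of_notMem hmem, add_zero]
    exact hω fun h => hmem (subset_toMeasurable μ B h)

end Comparison

/-! ### The mean of the noise ratio -/

section Moments

variable {n : ℕ} {Ω : Type*} [MeasurableSpace Ω] {μ : Measure Ω} {p : ℝ}
  {w : Fin n → ℝ} {Θ : Ω → Matrix (Fin n) (Fin n) ℝ}

namespace IsNoisyOffsets

theorem aemeasurable_noise (hΘ : IsNoisyOffsets μ p w Θ) (y : EuclideanSpace ℂ (Fin n)) :
    AEMeasurable (fun ω => Matrix.toEuclideanLin (noiseMatrix p w (Θ ω)) y) μ := by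
  simp only [Matrix.toLpLin_apply]
  refine (WithLp.measurable_toLp 2 _).comp_aemeasurable (aemeasurable_pi_iff.2 fun i => ?_)
  simp only [Matrix.mulVec, dotProduct]
  exact Finset.aemeasurable_fun_sum _ fun j _ => (hΘ.aemeasurable_noiseMatrix i j).mul_const _

theorem aemeasurable_noiseRatio (hΘ : IsNoisyOffsets μ p w Θ) :
    AEMeasurable (fun ω => noiseRatio p w (Θ ω)) μ := by
  have h : Continuous fun x : EuclideanSpace ℂ (Fin n) =>
      ‖perp (trueVector w) x‖ ^ 2 / (n * p) ^ 2 := by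
    unfold perp
    fun_prop
  exact h.measurable.comp_aemeasurable (hΘ.aemeasurable_noise (trueVector w))

/-- The mean of `noiseRatio` is `(1 - p²) / (n p²)` up to a relative error `5 / n`. -/
theorem integral_noiseRatio [IsProbabilityMeasure μ] (hΘ : IsNoisyOffsets μ p w Θ)
    (hn : 0 < n) (hp : 0 < p) (hp' : p ≤ 1) :
    n * p ^ 2 * ∫ ω, noiseRatio p w (Θ ω) ∂μ ≤ 1 - p ^ 2 ∧
      (1 - 5 / n) * (1 - p ^ 2) ≤ n * p ^ 2 * ∫ ω, noiseRatio p w (Θ ω) ∂μ := by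
  have hn' : (0 : ℝ) < n := Nat.cast_pos.2 hn
  have hq : 0 ≤ 1 - p ^ 2 := by nlinarith
  set z := trueVector w with hzdef
  have hz : ‖z‖ = 1 := norm_trueVector hn w
  set T : Ω → EuclideanSpace ℂ (Fin n) :=
    fun ω => Matrix.toEuclideanLin (noiseMatrix p w (Θ ω)) z with hT
  have hTm : AEMeasurable T μ := hΘ.aemeasurable_noise z
  have hTb : ∀ ω, ‖T ω‖ ^ 2 ≤ 4 * (n : ℝ) ^ 2 :=
    fun ω => norm_noise_trueVector_sq_le hp.le hp' hn (Θ ω)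
  have hin : ∀ x : EuclideanSpace ℂ (Fin n), ‖x‖ = 1 → ∀ ω, ‖inner ℂ x (T ω)‖ ^ 2 ≤ 4 * (n : ℝ) ^ 2 :=
    fun x hx ω => by
    refine le_trans ?_ (hTb ω)
    gcongr
    simpa [hx] using norm_inner_le_norm (𝕜 := ℂ) x (T ω)
  have hreint : ∀ x : EuclideanSpace ℂ (Fin n), ‖x‖ = 1 →
      Integrable (fun ω => (inner ℂ x (T ω)).re ^ 2) μ := fun x hx => by
    have hc : Continuous fun y : EuclideanSpace ℂ (Fin n) => (inner ℂ x y).re ^ 2 := by fun_prop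
    refine Integrable.of_bound (hc.measurable.comp_aemeasurable hTm).aestronglyMeasurable
      (4 * (n : ℝ) ^ 2) (Filter.Eventually.of_forall fun ω => ?_)
    rw [norm_pow, Real.norm_eq_abs]
    refine le_trans ?_ (hin x hx ω)
    gcongr
    exact Complex.abs_re_le_norm _
  have hiz : ‖Complex.I • z‖ = 1 := by rw [norm_smul, hz]; simp
  -- The imaginary part of `⟨z, T⟩` is, up to sign, the real part of `⟨I z, T⟩`. Each squared part
  -- has mean at most `2 (1 - p²)`; with the `-1` in `n - 1` this makes the `5` of the lower bound.
  have hsplit : ∀ ω, ‖perp z (T ω)‖ ^ 2 = ‖T ω‖ ^ 2 -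
      ((inner ℂ z (T ω)).re ^ 2 + (inner ℂ (Complex.I • z) (T ω)).re ^ 2) := fun ω => by
    rw [norm_perp_sq hz, inner_smul_left, ← Complex.normSq_eq_norm_sq, Complex.normSq_apply]
    simp
    ring
  have hTi : Integrable (fun ω => ‖T ω‖ ^ 2) μ :=
    Integrable.of_bound (hTm.norm.pow_const 2).aestronglyMeasurable (4 * (n : ℝ) ^ 2)
      (Filter.Eventually.of_forall fun ω => by rw [norm_pow, norm_norm]; exact hTb ω)
  have hTint : ∫ ω, ‖T ω‖ ^ 2 ∂μ = (n - 1) * (1 - p ^ 2) := by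
    rw [hΘ.integral_norm_noise_sq hp.le hp' (norm_trueVector_apply w), div_pow, one_pow,
      Real.sq_sqrt hn'.le]
    field_simp
  have hI1 := hΘ.integral_re_inner_noise_sq_le hp.le hp' z z
  have hI2 := hΘ.integral_re_inner_noise_sq_le hp.le hp' (Complex.I • z) z
  rw [hz] at hI1
  rw [hiz, hz] at hI2
  have hN1 : 0 ≤ ∫ ω, (inner ℂ z (T ω)).re ^ 2 ∂μ := integral_nonneg fun ω => sq_nonneg _
  have hN2 : 0 ≤ ∫ ω, (inner ℂ (Complex.I • z) (T ω)).re ^ 2 ∂μ :=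
    integral_nonneg fun ω => sq_nonneg _
  have hval : n * p ^ 2 * ∫ ω, noiseRatio p w (Θ ω) ∂μ =
      ((n - 1) * (1 - p ^ 2) - (∫ ω, (inner ℂ z (T ω)).re ^ 2 ∂μ +
        ∫ ω, (inner ℂ (Complex.I • z) (T ω)).re ^ 2 ∂μ)) / n := by
    have : ∀ ω, noiseRatio p w (Θ ω) = ‖perp z (T ω)‖ ^ 2 / (n * p) ^ 2 := fun ω => rfl
    simp only [this, hsplit]
    have hsum : Integrable (fun ω => (inner ℂ z (T ω)).re ^ 2 +
        (inner ℂ (Complex.I • z) (T ω)).re ^ 2) μ := (hreint z hz).add (hreint _ hiz)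
    rw [integral_div, integral_sub hTi hsum, integral_add (hreint z hz) (hreint _ hiz), hTint]
    field_simp
  rw [hval]
  constructor
  · rw [div_le_iff₀ hn']
    nlinarith
  · rw [le_div_iff₀ hn']
    have : (1 - 5 / (n : ℝ)) * (1 - p ^ 2) * n = (n - 5) * (1 - p ^ 2) := by field_simp
    rw [this]
    simp only [hT] at *
    linarith

end IsNoisyOffsets

end Moments

end AttrSync

/-! ### Choice of constants and the rate -/

namespace AttrSync

theorem aemeasurable_correlation {n : ℕ} {Ω : Type*} [MeasurableSpace Ω] {μ : Measure Ω}
    (z : EuclideanSpace ℂ (Fin n)) {v : Ω → EuclideanSpace ℂ (Fin n)} (hv : AEMeasurable v μ) :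
    AEMeasurable (fun ω => correlation z (v ω)) μ := by
  have hc : Continuous fun y : EuclideanSpace ℂ (Fin n) => ‖inner ℂ z y‖ := by fun_prop
  exact (hc.measurable.comp_aemeasurable hv).div (hv.norm.const_mul _)

theorem aemeasurable_tanSq_angle {n : ℕ} {Ω : Type*} [MeasurableSpace Ω] {μ : Measure Ω}
    (z : EuclideanSpace ℂ (Fin n)) {v : Ω → EuclideanSpace ℂ (Fin n)} (hv : AEMeasurable v μ) :
    AEMeasurable (fun ω => tanSq (angle z (v ω))) μ := by
  simp only [tanSq, sin_angle_sq, cos_angle]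
  have h := (aemeasurable_correlation z hv).pow_const 2
  exact ((h.const_sub 1).ennreal_ofReal).div h.ennreal_ofReal

/-- The failure probability of the operator norm bound beats the truncation level `exp n`. -/
theorem failure_bound {n : ℕ} {p δ ε κ : ℝ} (hn : 0 < n) (hp : 0 < p) (hp' : p ≤ 1) (hε : 0 < ε)
    (hδ : 0 < δ) (h32 : 32 ≤ δ * (n * p)) (hκ : 11 + 10 / ε ≤ κ)
    (hκ' : 1024 * κ ≤ δ ^ 2 * (n * p ^ 2)) {K : ℝ} (hK : K ≤ Real.exp n) :
    n * p ^ 2 * ((K + 4 / p ^ 2) * ((n : ℝ) ^ 2 * 625 ^ n *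
      ((1 - p) * Real.exp (-(δ * (n * p) - 16) ^ 2 / 256)))) ≤ ε / 2 * (1 - p ^ 2) := by
  have hn' : (1 : ℝ) ≤ n := by exact_mod_cast hn
  have hp2 : p ^ 2 ≤ 1 := pow_le_one₀ hp.le hp'
  have hne : (n : ℝ) ≤ Real.exp n := by linarith [Real.add_one_le_exp (n : ℝ)]
  have h1e : 1 ≤ Real.exp (n : ℝ) := hn'.trans hne
  have hq : 0 ≤ 1 - p := by linarith
  have hA : n * p ^ 2 * (K + 4 / p ^ 2) ≤ 5 * Real.exp n ^ 2 := by
    have e : n * p ^ 2 * (K + 4 / p ^ 2) = n * (p ^ 2 * K) + 4 * n := by field_simp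
    have h1 : p ^ 2 * K ≤ 1 * Real.exp n := by
      calc p ^ 2 * K ≤ p ^ 2 * Real.exp n := by gcongr
        _ ≤ 1 * Real.exp n := by gcongr
    have h2 : n * (p ^ 2 * K) ≤ Real.exp n * (1 * Real.exp n) :=
      (mul_le_mul_of_nonneg_left h1 (by linarith)).trans
        (mul_le_mul_of_nonneg_right hne (by positivity))
    rw [e]
    nlinarith
  have hB : (n : ℝ) ^ 2 * 625 ^ n ≤ Real.exp n ^ 2 * Real.exp n ^ 7 := by
    have h1 : (625 : ℝ) ^ n ≤ Real.exp n ^ 7 := by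
      have h2 : (625 : ℝ) ≤ Real.exp 1 ^ 7 := by
        have := Real.exp_one_gt_d9
        calc (625 : ℝ) ≤ (2.7 : ℝ) ^ 7 := by norm_num
          _ ≤ Real.exp 1 ^ 7 := by gcongr; linarith
      calc (625 : ℝ) ^ n ≤ (Real.exp 1 ^ 7) ^ n := by gcongr
        _ = Real.exp n ^ 7 := by rw [← pow_mul, mul_comm, pow_mul, Real.exp_one_pow]
    gcongr
  -- Since `t = δnp ≥ 32`, `t - 16 ≥ t / 2`, so the exponent is at least `t² / 1024 ≥ κn` in
  -- absolute value.
  have hC : Real.exp (-(δ * (n * p) - 16) ^ 2 / 256) ≤ Real.exp (-κ * n) := by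
    refine Real.exp_le_exp.2 ?_
    have h1 : (δ * (n * p) / 2) ^ 2 ≤ (δ * (n * p) - 16) ^ 2 := by
      refine pow_le_pow_left₀ (by positivity) (by linarith) 2
    have h2 : 1024 * κ * n ≤ δ ^ 2 * (n * p ^ 2) * n :=
      mul_le_mul_of_nonneg_right hκ' (by linarith)
    have h3 : (δ * (n * p) / 2) ^ 2 = δ ^ 2 * (n * p ^ 2) * n / 4 := by ring
    rw [div_le_iff₀ (by norm_num)]
    linarith
  -- The power `11 = 2 + 2 + 7` collects the truncation terms, `n²` and `625^n`; the `10 / ε` in `κ`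
  -- then makes the product small.
  have hD : Real.exp n ^ 11 * Real.exp (-κ * n) ≤ ε / 10 := by
    rw [← Real.exp_nat_mul, ← Real.exp_add]
    have h1 : ((11 : ℕ) : ℝ) * n + -κ * n ≤ -(10 / ε) := by
      push_cast
      have h0 : 0 < 10 / ε := by positivity
      have h2 : (10 / ε) * 1 ≤ (κ - 11) * n :=
        mul_le_mul (by linarith) hn' (by norm_num) (by linarith)
      linarith
    refine (Real.exp_le_exp.2 h1).trans ?_
    have h3 : 10 / ε ≤ Real.exp (10 / ε) := by linarith [Real.add_one_le_exp (10 / ε)]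
    rw [Real.exp_neg]
    calc (Real.exp (10 / ε))⁻¹ ≤ (10 / ε)⁻¹ := inv_anti₀ (by positivity) h3
      _ = ε / 10 := by rw [inv_div]
  have hAnn : 0 ≤ (n : ℝ) ^ 2 * 625 ^ n * ((1 - p) *
      Real.exp (-(δ * (n * p) - 16) ^ 2 / 256)) := by positivity
  calc _ = n * p ^ 2 * (K + 4 / p ^ 2) * ((n : ℝ) ^ 2 * 625 ^ n *
        ((1 - p) * Real.exp (-(δ * (n * p) - 16) ^ 2 / 256))) := by ring
    _ ≤ 5 * Real.exp n ^ 2 * (Real.exp n ^ 2 * Real.exp n ^ 7 *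
        ((1 - p) * Real.exp (-κ * n))) := by gcongr
    _ = 5 * (Real.exp n ^ 11 * Real.exp (-κ * n)) * (1 - p) := by ring
    _ ≤ 5 * (ε / 10) * (1 - p) := by gcongr
    _ ≤ ε / 2 * (1 - p ^ 2) := by nlinarith [mul_nonneg hp.le hq]

/-- The rate of the squared sine and of the truncated squared tangent of the angle. -/
theorem exists_rate (ε : ℝ) (hε : 0 < ε) : ∃ M : ℝ, 0 < M ∧
    ∀ (n : ℕ) (p : ℝ) (w : Fin n → ℝ)
      (Ω : Type*) [MeasurableSpace Ω] (μ : Measure Ω) [IsProbabilityMeasure μ]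
      (Θ : Ω → Matrix (Fin n) (Fin n) ℝ) (v : Ω → EuclideanSpace ℂ (Fin n)),
      0 < p → p ≤ 1 → IsNoisyOffsets μ p w Θ → AEMeasurable v μ →
      (∀ᵐ ω ∂μ, IsTopEigenvector (phaseMatrix (Θ ω)) (v ω)) → M ≤ n * p ^ 2 →
      (∀ K : ℝ, 1 ≤ K → K ≤ Real.exp n →
        |n * p ^ 2 * truncMeanTanSq μ (fun ω => angle (trueVector w) (v ω)) K - (1 - p ^ 2)|
          ≤ ε * (1 - p ^ 2)) ∧
      |n * p ^ 2 * (∫ ω, (1 - correlation (trueVector w) (v ω) ^ 2) ∂μ) - (1 - p ^ 2)|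
        ≤ ε * (1 - p ^ 2) := by
  -- Error budget: `ε/4` for replacing the angle by `noiseRatio`, `ε/4` for the mean of
  -- `noiseRatio`, `ε/2` for the failure event.
  obtain ⟨δ, hδ, hδ1, hδ2⟩ : ∃ δ : ℝ, 0 < δ ∧ δ ≤ 1 / 10 ∧ 8 * δ ≤ ε / 4 :=
    ⟨min (1 / 10) (ε / 32), by positivity, min_le_left _ _, by
      linarith [min_le_right (1 / 10) (ε / 32)]⟩
  set κ : ℝ := 11 + 10 / ε with hκ
  have hκ0 : 0 < κ := by positivity
  -- The three summands yield `5 / n ≤ ε / 4`, `δnp ≥ 32` and the exponent `κ`, respectively.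
  refine ⟨20 / ε + 32 / δ + 1024 * κ / δ ^ 2, by positivity, ?_⟩
  intro n p w Ω _ μ _ Θ v hp hp' hΘ hvm hv hM
  have a1 : 0 < 20 / ε := by positivity
  have a2 : 0 < 32 / δ := by positivity
  have a3 : 0 < 1024 * κ / δ ^ 2 := by positivity
  have hp2 : p ^ 2 ≤ 1 := pow_le_one₀ hp.le hp'
  have hn : 0 < n := by
    rcases Nat.eq_zero_or_pos n with rfl | h
    · rw [Nat.cast_zero, zero_mul] at hM; linarith
    · exact h
  have hn' : (0 : ℝ) < n := Nat.cast_pos.2 hn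
  have hq : 0 ≤ 1 - p ^ 2 := by linarith
  have b1 : 5 / (n : ℝ) ≤ ε / 4 := by
    have h1 : 20 / ε ≤ n := by
      have : n * p ^ 2 ≤ n * 1 := by gcongr
      linarith
    rw [div_le_iff₀ hε] at h1
    rw [div_le_iff₀ hn']
    linarith
  have b2 : 32 ≤ δ * (n * p) := by
    have h1 : 32 / δ ≤ n * p := by
      have : n * p ^ 2 ≤ n * p := by gcongr; nlinarith
      linarith
    rw [div_le_iff₀ hδ] at h1
    linarith
  have b3 : 1024 * κ ≤ δ ^ 2 * (n * p ^ 2) := by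
    have h1 : 1024 * κ / δ ^ 2 ≤ n * p ^ 2 := by linarith
    rw [div_le_iff₀ (by positivity)] at h1
    linarith
  let B : Set Ω := {ω | (∃ e : {e : Fin n × Fin n // e.1 < e.2},
      Θ ω e.1.1 e.1.2 ≠ w e.1.1 - w e.1.2) ∧
      ¬ ∀ x, ‖Matrix.toEuclideanLin (noiseMatrix p w (Θ ω)) x‖ ≤ δ * (n * p) * ‖x‖}
  have hB : μ.real B ≤ _ := hΘ.measureReal_noise_large_le hp.le hp' (by linarith)
  have hclose : ∀ᵐ ω ∂μ, ω ∉ B →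
      |(1 - correlation (trueVector w) (v ω) ^ 2) - noiseRatio p w (Θ ω)| ≤
        8 * δ * noiseRatio p w (Θ ω) ∧
      ∀ K : ℝ, 1 ≤ K →
        |(min (tanSq (angle (trueVector w) (v ω))) (ENNReal.ofReal K)).toReal -
          noiseRatio p w (Θ ω)| ≤ 8 * δ * noiseRatio p w (Θ ω) := by
    filter_upwards [hv] with ω hω hnot
    refine hω.close_to_noiseRatio hn hp (hΘ.skew ω) hδ.le hδ1 ?_
    by_contra! hcon
    exact hnot ⟨hcon.1, fun h => by
      obtain ⟨x, hx⟩ := hcon.2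
      exact absurd (h x) (not_le.2 hx)⟩
  obtain ⟨m1, m2⟩ := hΘ.integral_noiseRatio hn hp hp'
  have hmain : ∀ (f : Ω → ℝ) (K : ℝ), AEMeasurable f μ → (∀ ω, 0 ≤ f ω) → (∀ ω, f ω ≤ K) →
      0 ≤ K → K ≤ Real.exp n →
      (∀ᵐ ω ∂μ, ω ∉ B → |f ω - noiseRatio p w (Θ ω)| ≤ 8 * δ * noiseRatio p w (Θ ω)) →
      |n * p ^ 2 * (∫ ω, f ω ∂μ) - (1 - p ^ 2)| ≤ ε * (1 - p ^ 2) := by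
    intro f K hf hf0 hfK hK0 hK hfB
    have h1 := abs_integral_sub_le hf hΘ.aemeasurable_noiseRatio hf0 hfK
      (fun ω => noiseRatio_nonneg) (fun ω => noiseRatio_le hp hp' hn) (by positivity) hfB
    have h2 : n * p ^ 2 * ((K + 4 / p ^ 2) * μ.real B) ≤ ε / 2 * (1 - p ^ 2) := by
      refine le_trans ?_ (failure_bound hn hp hp' hε hδ b2 le_rfl b3 hK)
      gcongr
    have h3 : n * p ^ 2 * |∫ ω, f ω ∂μ - ∫ ω, noiseRatio p w (Θ ω) ∂μ| ≤
        8 * δ * (n * p ^ 2 * ∫ ω, noiseRatio p w (Θ ω) ∂μ) +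
          n * p ^ 2 * ((K + 4 / p ^ 2) * μ.real B) := by
      refine (mul_le_mul_of_nonneg_left h1 (by positivity)).trans (le_of_eq ?_)
      ring
    have h4 : 8 * δ * (n * p ^ 2 * ∫ ω, noiseRatio p w (Θ ω) ∂μ) ≤ ε / 4 * (1 - p ^ 2) := by
      refine (mul_le_mul_of_nonneg_left m1 (by positivity)).trans ?_
      gcongr
    have h5 : 5 / (n : ℝ) * (1 - p ^ 2) ≤ ε / 4 * (1 - p ^ 2) := by gcongr
    have h6 : |n * p ^ 2 * (∫ ω, noiseRatio p w (Θ ω) ∂μ) - (1 - p ^ 2)| ≤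
        ε / 4 * (1 - p ^ 2) :=
      abs_le.2 ⟨by linarith, by linarith [mul_nonneg (by positivity : 0 ≤ ε / 4) hq]⟩
    have e : n * p ^ 2 * (∫ ω, f ω ∂μ) - (1 - p ^ 2) =
        n * p ^ 2 * (∫ ω, f ω ∂μ - ∫ ω, noiseRatio p w (Θ ω) ∂μ) +
          (n * p ^ 2 * (∫ ω, noiseRatio p w (Θ ω) ∂μ) - (1 - p ^ 2)) := by ring
    rw [e]
    refine (abs_add_le _ _).trans ?_
    rw [abs_mul, abs_of_nonneg (by positivity : (0 : ℝ) ≤ n * p ^ 2)]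
    linarith
  constructor
  · intro K hK1 hK
    have hm := (aemeasurable_tanSq_angle (trueVector w) hvm).min
      (aemeasurable_const (b := ENNReal.ofReal K))
    have hlt : ∀ ω, min (tanSq (angle (trueVector w) (v ω))) (ENNReal.ofReal K) < ∞ :=
      fun ω => (min_le_right _ _).trans_lt ENNReal.ofReal_lt_top
    rw [truncMeanTanSq, ← integral_toReal hm (Filter.Eventually.of_forall hlt)]
    refine hmain _ K hm.ennreal_toReal (fun ω => ENNReal.toReal_nonneg) (fun ω => ?_)
      (by linarith) hK ?_
    · exact ENNReal.toReal_le_of_le_ofReal (by linarith) (min_le_right _ _)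
    · filter_upwards [hclose] with ω hω hnot using (hω hnot).2 K hK1
  · refine hmain _ 1 ((aemeasurable_correlation _ hvm).pow_const 2 |>.const_sub 1) (fun ω => ?_)
      (fun ω => by linarith [sq_nonneg (correlation (trueVector w) (v ω))]) zero_le_one
      (Real.one_le_exp hn'.le) ?_
    · have := pow_le_one₀ (n := 2) (correlation_nonneg (trueVector w) (v ω))
        (correlation_le_one (trueVector w) (v ω))
      linarith
    · filter_upwards [hclose] with ω hω hnot using (hω hnot).1

/-- Jordan's inequality `sin α ≥ 2α / π` together with `π ≤ 4`. -/
theorem sq_div_four_le_of_lt_angle {n : ℕ} {z v : EuclideanSpace ℂ (Fin n)} {ε : ℝ} (hε : 0 < ε)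
    (h : ε < angle z v) : ε ^ 2 / 4 ≤ 1 - correlation z v ^ 2 := by
  have h2 : angle z v ≤ Real.pi / 2 := Real.arccos_le_pi_div_two.2 (correlation_nonneg z v)
  have h3 := Real.mul_le_sin (hε.le.trans h.le) h2
  have h4 : 1 / 2 ≤ 2 / Real.pi := by
    rw [div_le_div_iff₀ (by norm_num) Real.pi_pos]
    linarith [Real.pi_le_four]
  have h5 : 1 / 2 * ε ≤ Real.sin (angle z v) :=
    (mul_le_mul h4 h.le hε.le (by positivity)).trans h3
  rw [← sin_angle_sq]
  calc ε ^ 2 / 4 = (1 / 2 * ε) ^ 2 := by ring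
    _ ≤ _ := pow_le_pow_left₀ (by positivity) h5 2

end AttrSync

/-! ### The main theorem -/

theorem theorem2 :
    ∃ c : ℝ, 0 < c ∧ ∀ ε : ℝ, 0 < ε → ∃ M : ℝ, 0 < M ∧
      ∀ (n : ℕ) (p : ℝ) (w : Fin n → ℝ)
        (Ω : Type*) [MeasurableSpace Ω] (μ : Measure Ω) [IsProbabilityMeasure μ]
        (Θ : Ω → Matrix (Fin n) (Fin n) ℝ) (v : Ω → EuclideanSpace ℂ (Fin n)),
        0 < p → p ≤ 1 →
        AttrSync.IsNoisyOffsets μ p w Θ →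
        AEMeasurable v μ →
        (∀ᵐ ω ∂μ, AttrSync.IsTopEigenvector (AttrSync.phaseMatrix (Θ ω)) (v ω)) →
        M ≤ n * p ^ 2 →
        -- `𝔼 tan² α ∼ (1 - p²) / (n p²)`, for every truncation level from `1` to `exp (c n)`
        (∀ K : ℝ, 1 ≤ K → K ≤ Real.exp (c * n) →
          |n * p ^ 2 * AttrSync.truncMeanTanSq μ
              (fun ω => AttrSync.angle (AttrSync.trueVector w) (v ω)) K - (1 - p ^ 2)|
            ≤ ε * (1 - p ^ 2)) ∧
        -- `𝔼 tan² α ∼ 1 / (n p²)` when moreover `p` is small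
        (M * p ≤ 1 → ∀ K : ℝ, 1 ≤ K → K ≤ Real.exp (c * n) →
          |n * p ^ 2 * AttrSync.truncMeanTanSq μ
              (fun ω => AttrSync.angle (AttrSync.trueVector w) (v ω)) K - 1| ≤ ε) ∧
        -- the same rate for the defect of the squared correlation, without truncation
        |n * p ^ 2 * (∫ ω, (1 - AttrSync.correlation (AttrSync.trueVector w) (v ω) ^ 2) ∂μ)
            - (1 - p ^ 2)| ≤ ε * (1 - p ^ 2) ∧
        -- the angle tends to zero in probability and the mean correlation tends to one
        μ.real {ω | ε < AttrSync.angle (AttrSync.trueVector w) (v ω)} ≤ ε ∧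
        1 - ε ≤ ∫ ω, AttrSync.correlation (AttrSync.trueVector w) (v ω) ∂μ := by
  refine ⟨1, one_pos, fun ε hε => ?_⟩
  -- The `ε / 2` leaves room for replacing `1 - p²` by `1` when `p` is small; the `1` gives `np² 𝔼(1
  -- - ρ²) ≤ 2`.
  obtain ⟨M, hM0, hrate⟩ := AttrSync.exists_rate (min (ε / 2) 1) (by positivity)
  -- The term `2 / ε` gives `I ≤ ε`, and `p ≤ ε / 2` when `p` is small; `8 / ε³` gives `I ≤ ε³ / 4`,
  -- as Markov's inequality at level `ε² / 4` requires.
  refine ⟨M + 1 + 2 / ε + 8 / ε ^ 3, by positivity, ?_⟩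
  intro n p w Ω _ μ _ Θ v hp hp' hΘ hvm hv hM
  have a1 : 0 < 2 / ε := by positivity
  have a2 : 0 < 8 / ε ^ 3 := by positivity
  have hp2 : p ^ 2 ≤ 1 := pow_le_one₀ hp.le hp'
  have hq : 0 ≤ 1 - p ^ 2 := by linarith
  have hε1 : min (ε / 2) 1 ≤ ε / 2 := min_le_left _ _
  have hε2 : min (ε / 2) 1 ≤ 1 := min_le_right _ _
  obtain ⟨h1, h3⟩ := hrate n p w Ω μ Θ v hp hp' hΘ hvm hv (by linarith)
  have hle : min (ε / 2) 1 * (1 - p ^ 2) ≤ ε / 2 * (1 - p ^ 2) := by gcongr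
  have hle' : ε / 2 * (1 - p ^ 2) ≤ ε * (1 - p ^ 2) := by gcongr; linarith
  have hle'' : ε / 2 * (1 - p ^ 2) ≤ ε / 2 := mul_le_of_le_one_right (by positivity) (by nlinarith)
  have hbound : ∀ ω, 0 ≤ 1 - AttrSync.correlation (AttrSync.trueVector w) (v ω) ^ 2 := fun ω => by
    have := pow_le_one₀ (n := 2) (AttrSync.correlation_nonneg (AttrSync.trueVector w) (v ω))
      (AttrSync.correlation_le_one (AttrSync.trueVector w) (v ω))
    linarith
  have hcm := AttrSync.aemeasurable_correlation (AttrSync.trueVector w) hvm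
  have hInt : Integrable
      (fun ω => 1 - AttrSync.correlation (AttrSync.trueVector w) (v ω) ^ 2) μ :=
    Integrable.of_bound ((hcm.pow_const 2).const_sub 1).aestronglyMeasurable 1
      (Filter.Eventually.of_forall fun ω => by
        rw [Real.norm_of_nonneg (hbound ω)]
        linarith [sq_nonneg (AttrSync.correlation (AttrSync.trueVector w) (v ω))])
  set I := ∫ ω, (1 - AttrSync.correlation (AttrSync.trueVector w) (v ω) ^ 2) ∂μ with hI
  have hI0 : 0 ≤ I := integral_nonneg hbound
  have hI2 : n * p ^ 2 * I ≤ 2 := by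
    have := (abs_le.1 h3).2
    have h4 : min (ε / 2) 1 * (1 - p ^ 2) ≤ 1 * 1 :=
      mul_le_mul hε2 (by nlinarith) hq one_pos.le
    nlinarith
  have hI3 : (2 / ε + 8 / ε ^ 3) * I ≤ 2 :=
    (mul_le_mul_of_nonneg_right (by linarith) hI0).trans hI2
  have hIε : I ≤ ε := by
    have h4 : 2 / ε * I ≤ 2 := by nlinarith
    rw [div_mul_eq_mul_div, div_le_iff₀ hε] at h4
    linarith
  have hIε3 : I ≤ ε ^ 3 / 4 := by
    have h4 : 8 / ε ^ 3 * I ≤ 2 := by nlinarith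
    rw [div_mul_eq_mul_div, div_le_iff₀ (by positivity)] at h4
    linarith
  refine ⟨fun K hK1 hK => ?_, fun hMp K hK1 hK => ?_, h3.trans (hle.trans hle'), ?_, ?_⟩
  · exact (h1 K hK1 (by rwa [one_mul] at hK)).trans (hle.trans hle')
  · have h4 := abs_le.1 ((h1 K hK1 (by rwa [one_mul] at hK)).trans (hle.trans hle''))
    have h5 : p ^ 2 ≤ ε / 2 := by
      have h6 : 2 / ε * p ≤ 1 := by
        refine le_trans ?_ hMp
        gcongr
        linarith
      rw [div_mul_eq_mul_div, div_le_iff₀ hε] at h6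
      nlinarith
    exact abs_le.2 ⟨by linarith [h4.1], by nlinarith [h4.2]⟩
  · have hmarkov := mul_meas_ge_le_integral_of_nonneg (Filter.Eventually.of_forall hbound) hInt
      (ε ^ 2 / 4)
    have hmono : μ.real {ω | ε < AttrSync.angle (AttrSync.trueVector w) (v ω)} ≤
        μ.real {ω | ε ^ 2 / 4 ≤ 1 - AttrSync.correlation (AttrSync.trueVector w) (v ω) ^ 2} :=
      measureReal_mono fun ω hω => AttrSync.sq_div_four_le_of_lt_angle hε hω
    refine hmono.trans ?_
    have h4 := hmarkov.trans hIε3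
    have h5 : ε ^ 2 / 4 * μ.real
        {ω | ε ^ 2 / 4 ≤ 1 - AttrSync.correlation (AttrSync.trueVector w) (v ω) ^ 2} ≤
        ε ^ 2 / 4 * ε := h4.trans (le_of_eq (by ring))
    exact le_of_mul_le_mul_left h5 (by positivity)
  · have hci : Integrable (fun ω => AttrSync.correlation (AttrSync.trueVector w) (v ω)) μ :=
      Integrable.of_bound hcm.aestronglyMeasurable 1 (Filter.Eventually.of_forall fun ω => by
        rw [Real.norm_of_nonneg (AttrSync.correlation_nonneg _ _)]
        exact AttrSync.correlation_le_one _ _)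
    -- Because `0 ≤ ρ ≤ 1`, `1 - ρ ≤ 1 - ρ²`.
    have hmono : ∫ ω, (1 - AttrSync.correlation (AttrSync.trueVector w) (v ω)) ∂μ ≤ I := by
      refine integral_mono ((integrable_const 1).sub hci) hInt fun ω => ?_
      have h4 := AttrSync.correlation_nonneg (AttrSync.trueVector w) (v ω)
      have h5 := AttrSync.correlation_le_one (AttrSync.trueVector w) (v ω)
      dsimp only
      nlinarith
    rw [integral_sub (integrable_const _) hci] at hmono
    simp at hmono
    linarith
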